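/- A digraph is a pair $(V,E)$ with $E\subseteq V^2$, viewed as a structure with one binary relation; a homomorphism is an edge-preserving map, and an embedding is an isomorphism onto an induced subdigraph. For $\ell\ge 1$ let $T_\ell$ be the transitive tournament $(\{1,\dots,\ell\};<)$, and let $\mathrm{Csp}(T_\ell)$ be the class of all finite digraphs that have a homomorphism to $T_\ell$. The almost-sure theory of a class $\mathcal C$ of finite digraphs is the set of first-order sentences $\varphi$ such that the fraction of those digraphs in $\mathcal C$ with vertex set $\{1,\dots,n\}$ that satisfy $\varphi$ tends to $1$ as $n\to\infty$. A primitive positive sentence is one of the form $\exists y_1,\dots,y_n\,(\psi_1\wedge\dots\wedge\psi_m)$ with atomic $\psi_i$ (of the form $E(x,y)$, $x=y$ or $\bot$). Let $\Sigma_\ell=\{\neg\varphi : \varphi \text{ a primitive positive sentence with } T_\ell\models\neg\varphi\}$. A model companion of a theory $\Sigma$ is a theory $\Sigma^*$ that has the same universal consequences as $\Sigma$ and is model complete (every embedding between models of $\Sigma^*$ preserves all first-order formulas). A theory is $\omega$-categorical if it is satisfiable and all its countable models are isomorphic. **Proposition.** Let $\ell\ge 1$. The theory $\Sigma_\ell$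 has a model companion. Every model companion of $\Sigma_\ell$ is $\omega$-categorical and has a countable model. If $U_{T_\ell}$ is a countable model of a model companion of $\Sigma_\ell$, then a countable digraph embeds into $U_{T_\ell}$ if and only if it has a homomorphism to $T_\ell$, and the almost-sure theory of $\mathrm{Csp}(T_\ell)$ equals the first-order theory of $U_{T_\ell}$. -/

import Mathlib

open FirstOrder FirstOrder.Language Filter Topology

namespace AlmostSure

/-! ### Model-theoretic notions -/

section ModelTheory

variable {L : FirstOrder.Language.{0, 0}}

/-- Finite conjunctions of atomic formulas. The atomic formulas are the equations, the relational
atoms and `⊥`; the formula `⊤` is the empty conjunction. -/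
inductive IsConjAtomic {α : Type} {n : ℕ} : L.BoundedFormula α n → Prop
  | top : IsConjAtomic ⊤
  | bot : IsConjAtomic ⊥
  | atomic {φ : L.BoundedFormula α n} (h : φ.IsAtomic) : IsConjAtomic φ
  | inf {φ ψ : L.BoundedFormula α n} (hφ : IsConjAtomic φ) (hψ : IsConjAtomic ψ) :
      IsConjAtomic (φ ⊓ ψ)

/-- Primitive positive formulas: `∃ y₁, …, yₘ` followed by a conjunction of atomic formulas. -/
inductive IsPrimitivePositive {α : Type} : ∀ {n : ℕ}, L.BoundedFormula α n → Prop
  | conj {n : ℕ} {φ : L.BoundedFormula α n} (h : IsConjAtomic φ) : IsPrimitivePositive φ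
  | ex {n : ℕ} {φ : L.BoundedFormula α (n + 1)} (h : IsPrimitivePositive φ) :
      IsPrimitivePositive φ.ex

/-- Two theories are companions if they have the same universal consequences. -/
def AreCompanions (T T' : L.Theory) : Prop :=
  ∀ φ : L.Sentence, φ.IsUniversal → ((T ⊨ᵇ φ) ↔ (T' ⊨ᵇ φ))

/-- A theory is model complete if every embedding between its models preserves all first-order
formulas (in both directions, which is automatic because of negation). -/
def IsModelComplete (T : L.Theory) : Prop :=
  ∀ (M N : Theory.ModelType.{0, 0, 0} T) (f : M ↪[L] N) (n : ℕ) (φ : L.Formula (Fin n))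
    (x : Fin n → M), φ.Realize (f ∘ x) ↔ φ.Realize x

/-- `T'` is a model companion of `T`. -/
def IsModelCompanion (T T' : L.Theory) : Prop :=
  AreCompanions T T' ∧ IsModelComplete T'

/-- A theory is `ω`-categorical if it is satisfiable and all its countable models are
isomorphic. -/
def IsOmegaCategorical (T : L.Theory) : Prop :=
  T.IsSatisfiable ∧
    ∀ M N : Theory.ModelType.{0, 0, 0} T, Countable M → Countable N → Nonempty (M ≃[L] N)

end ModelTheory

/-! ### Digraphs as first-order structures -/

/-- A digraph as a structure in the language with one binary relation symbol. -/
@[reducible]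
def toStructure {V : Type} (G : Digraph V) : Language.graph.Structure V where
  RelMap | .adj => fun x => G.Adj (x 0) (x 1)

/-- The sentence `φ` holds in the digraph `G`. -/
def Satisfies {V : Type} (G : Digraph V) (φ : Language.graph.Sentence) : Prop :=
  letI := toStructure G
  V ⊨ φ

/-- The first-order theory of a digraph. -/
def theoryOf {V : Type} (G : Digraph V) : Language.graph.Theory :=
  {φ | Satisfies G φ}

/-- The digraph `G` has a homomorphism to the digraph `H`. -/
def MapsTo {V W : Type} (G : Digraph V) (H : Digraph W) : Prop :=
  Nonempty (G.Adj →r H.Adj)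

/-- The digraph `G` embeds into the digraph `H`, that is, it is isomorphic to an induced
subdigraph of `H`. -/
def EmbedsIn {V W : Type} (G : Digraph V) (H : Digraph W) : Prop :=
  Nonempty (G.Adj ↪r H.Adj)

/-- The theory `{¬ φ | φ primitive positive and D ⊨ ¬ φ}`. -/
def ppTheory {V : Type} (D : Digraph V) : Language.graph.Theory :=
  {θ | ∃ φ : Language.graph.Sentence,
    IsPrimitivePositive φ ∧ Satisfies D (∼φ) ∧ θ = ∼φ}

/-- The transitive tournament with `k` vertices. -/
def transitiveTournament (k : ℕ) : Digraph (Fin k) where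
  Adj i j := i < j

/-! ### Almost-sure theories -/

/-- A class of digraphs. -/
abbrev DigraphClass : Type 1 := ∀ V : Type, Set (Digraph V)

/-- The class of all finite digraphs with a homomorphism to `H`. -/
def Csp {W : Type} (H : Digraph W) : DigraphClass :=
  fun V => {G | Finite V ∧ MapsTo G H}

/-- The fraction of those labelled digraphs with `n` vertices in the class that satisfy `φ`. -/
noncomputable def fraction (C : DigraphClass) (φ : Language.graph.Sentence) (n : ℕ) : ℝ :=
  ({G ∈ C (Fin n) | Satisfies G φ}.ncard : ℝ) / ((C (Fin n)).ncard : ℝ)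

/-- The almost-sure theory of a class of digraphs. -/
def almostSureTheory (C : DigraphClass) : Language.graph.Theory :=
  {φ | Tendsto (fraction C φ) atTop (𝓝 1)}

end AlmostSure

/-!
Call a digraph `E` with a colouring `h : V → Fin l`, that is, a homomorphism to `T_l`, *generic* if
over every finite set `F` of vertices and in every colour class there is a vertex outside `F` with a
prescribed adjacency to the vertices of `F` of other colours (`IsGeneric`). Everything follows from
a study of generic digraphs.

* In a generic digraph a vertex of colour `k` ends a walk with `k` edges and starts one with
  `l - 1 - k` edges. This forces its colour in every colouring (`Extends.coloring_unique`), so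
  embeddings between generic digraphs preserve colours, and genericity is a first-order property
  (`IsGeneric.of_model_completeTheory`).
* Back and forth (`Matched.exists_match`) shows that countable generic digraphs are isomorphic, that
  every countable colourable digraph embeds into them, and that a formula has the same truth value
  on tuples with the same colours and the same atomic type. For a fixed formula the last statement
  needs the extension property only over sets of at most `R` vertices, where `R` depends on the
  formula (`exists_genericity_bound`).
* The models of `ppTheory T_l` are the colourable digraphs (`model_ppTheory_iff`). Hence the theory
  of a countable generic digraph is a model companion (`IsGeneric.isModelCompanion`).
* Let `N` be a countable model of an arbitrary model companion. It embeds into a countable generic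
  digraph, which embeds into a model `K` of the companion, an ultraproduct
  (`exists_embedding_of_universal`). By model completeness `N` is an elementary substructure of `K`,
  so the witnesses for genericity found in between exist in `N` as well: `N` is generic
  (`IsModelCompanion.exists_isGeneric`).
* For the almost-sure theory it remains to see that almost all colourable digraphs on `n` vertices
  are generic over sets of at most `R` vertices (`tendsto_card_genericSets`). For a fixed colouring
  with all classes of size at least `n / (2 l)`, a union bound shows that all but an exponentially
  small proportion of the digraphs with this colouring are generic (`card_filter_not_generic`), and
  these have only one colouring. The colourings with a smaller class admit at most
  `2 ^ (e - (l + 1) n)` digraphs each, where `2 ^ e` is the number of digraphs coloured by residues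
  modulo `l` (`card_admissible_add_le`), and there are only `l ^ n` of them.
-/

namespace AlmostSure


/-! ### Colourings and walks -/

section Relations

variable {V W : Type} {l : ℕ}

/-- A colouring of `E` is a homomorphism to the transitive tournament `T_l`. -/
def IsColoring (E : V → V → Prop) (h : V → Fin l) : Prop :=
  ∀ u v, E u v → h u < h v

/-- There is a directed walk with `k` edges that ends at `v`. -/
def InWalk (E : V → V → Prop) : ℕ → V → Prop
  | 0, _ => True
  | k + 1, v => ∃ u, E u v ∧ InWalk E k u

/-- There are a walk with `k` edges ending at `v` and a walk with `l - 1 - k` edges starting at `v`.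
This condition is existential, and it forces the colour `k` on `v` in every colouring. -/
def HasLevel (E : V → V → Prop) (l k : ℕ) (v : V) : Prop :=
  InWalk E k v ∧ InWalk (flip E) (l - 1 - k) v

theorem IsColoring.le_of_inWalk {E : V → V → Prop} {h : V → Fin l} (hc : IsColoring E h) :
    ∀ {k : ℕ} {v : V}, InWalk E k v → k ≤ h v
  | 0, _, _ => Nat.zero_le _
  | _ + 1, _, ⟨u, hu, hw⟩ => (hc.le_of_inWalk hw).trans_lt (hc u _ hu)

theorem IsColoring.add_lt_of_inWalk_flip {E : V → V → Prop} {h : V → Fin l}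
    (hc : IsColoring E h) : ∀ {k : ℕ} {v : V}, InWalk (flip E) k v → (h v : ℕ) + k < l
  | 0, v, _ => (h v).isLt
  | k + 1, v, ⟨u, hu, hw⟩ => by
    have h1 := hc.add_lt_of_inWalk_flip hw
    have h2 : (h v : ℕ) < h u := hc _ _ hu
    omega

theorem IsColoring.eq_of_hasLevel {E : V → V → Prop} {h : V → Fin l} (hc : IsColoring E h)
    {k : ℕ} {v : V} (hv : HasLevel E l k v) : (h v : ℕ) = k := by
  have h1 := hc.le_of_inWalk hv.1
  have h2 := hc.add_lt_of_inWalk_flip hv.2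
  omega

theorem InWalk.map {E : V → V → Prop} {E' : W → W → Prop} (f : V → W)
    (hf : ∀ u v, E u v → E' (f u) (f v)) :
    ∀ {k : ℕ} {v : V}, InWalk E k v → InWalk E' k (f v)
  | 0, _, _ => trivial
  | _ + 1, _, ⟨u, hu, hw⟩ => ⟨f u, hf _ _ hu, hw.map f hf⟩

theorem HasLevel.map {E : V → V → Prop} {E' : W → W → Prop} (f : V → W)
    (hf : ∀ u v, E u v → E' (f u) (f v)) {k : ℕ} {v : V} (hv : HasLevel E l k v) :
    HasLevel E' l k (f v) :=
  ⟨hv.1.map f hf, InWalk.map (E := flip E) (E' := flip E') f (fun _ _ => hf _ _) hv.2⟩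

/-- A digraph without walks of length `l` is coloured by the length of the longest walk into a
vertex. -/
theorem exists_isColoring {E : V → V → Prop} (hE : ∀ v, ¬ InWalk E l v) :
    ∃ h : V → Fin l, IsColoring E h := by
  classical
  have hspec : ∀ v, InWalk E (Nat.findGreatest (fun k => InWalk E k v) l) v := fun v =>
    Nat.findGreatest_spec (P := fun k => InWalk E k v) (Nat.zero_le l) trivial
  have hlt : ∀ v, Nat.findGreatest (fun k => InWalk E k v) l < l := fun v =>
    lt_of_le_of_ne (Nat.findGreatest_le _) fun h => hE v (by simpa only [h] using hspec v)
  exact ⟨fun v => ⟨_, hlt v⟩, fun u v huv => Nat.le_findGreatest (hlt u) ⟨u, huv, hspec u⟩⟩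

/-! ### Generic coloured digraphs -/

/-- The extension property over sets of `m` vertices: over every such set `F` there is, in every
colour class, a vertex outside `F` with a prescribed adjacency to those vertices of `F` that lie in
other colour classes. -/
def Extends (E : V → V → Prop) (h : V → Fin l) (m : ℕ) : Prop :=
  ∀ F : Finset V, F.card = m → ∀ (P : V → Prop) (k : Fin l),
    ∃ x, x ∉ F ∧ h x = k ∧ ∀ y ∈ F, (h y < k → (E y x ↔ P y)) ∧ (k < h y → (E x y ↔ P y))

/-- A coloured digraph with the extension property over all sets of at most `R` vertices. -/
structure IsGenericUpTo (E : V → V → Prop) (h : V → Fin l) (R : ℕ) : Prop where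
  isColoring : IsColoring E h
  ext : ∀ m ≤ R, Extends E h m

/-- A coloured digraph with the extension property over all finite sets of vertices. -/
def IsGeneric (E : V → V → Prop) (h : V → Fin l) : Prop :=
  ∀ R, IsGenericUpTo E h R

theorem IsGenericUpTo.mono {E : V → V → Prop} {h : V → Fin l} {R S : ℕ}
    (hg : IsGenericUpTo E h R) (hS : S ≤ R) : IsGenericUpTo E h S :=
  ⟨hg.isColoring, fun m hm => hg.ext m (hm.trans hS)⟩

theorem Extends.inWalk {E : V → V → Prop} {h : V → Fin l} (he : Extends E h 1) :
    ∀ (k : ℕ) (v : V), (h v : ℕ) = k → InWalk E k v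
  | 0, _, _ => trivial
  | k + 1, v, hv => by
    obtain ⟨x, -, hx, hxv⟩ := he {v} (Finset.card_singleton v) (fun _ => True)
      ⟨k, by have := (h v).isLt; omega⟩
    have hlt : (⟨k, by have := (h v).isLt; omega⟩ : Fin l) < h v := Fin.lt_def.2 (by simp [hv])
    exact ⟨x, ((hxv v (Finset.mem_singleton_self v)).2 hlt).2 trivial,
      he.inWalk k x (by rw [hx])⟩

theorem Extends.inWalk_flip {E : V → V → Prop} {h : V → Fin l} (he : Extends E h 1) :
    ∀ (k : ℕ) (v : V), (h v : ℕ) + k + 1 = l → InWalk (flip E) k v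
  | 0, _, _ => trivial
  | k + 1, v, hv => by
    obtain ⟨x, -, hx, hxv⟩ := he {v} (Finset.card_singleton v) (fun _ => True)
      ⟨h v + 1, by omega⟩
    have hlt : h v < (⟨h v + 1, by omega⟩ : Fin l) := Fin.lt_def.2 (by simp)
    exact ⟨x, ((hxv v (Finset.mem_singleton_self v)).1 hlt).2 trivial,
      he.inWalk_flip k x (by rw [hx]; simp only; omega)⟩

theorem Extends.hasLevel {E : V → V → Prop} {h : V → Fin l} (he : Extends E h 1) (v : V) :
    HasLevel E l (h v) v :=
  ⟨he.inWalk _ v rfl, he.inWalk_flip _ v (by have := (h v).isLt; omega)⟩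

/-- A digraph with the extension property over single vertices has only one colouring. -/
theorem Extends.coloring_unique {E : V → V → Prop} {h h' : V → Fin l} (he : Extends E h 1)
    (hc' : IsColoring E h') : h' = h :=
  funext fun v => Fin.ext (hc'.eq_of_hasLevel (he.hasLevel v))

/-- The vertex set of the generic digraph is `ℕ`. Each `n` codes a finite set of numbers and a
colour, and `m`, `n` with different colours are adjacent if one belongs to the set coded by the
other. -/
theorem exists_isGeneric_nat (hl : 1 ≤ l) :
    ∃ (E : ℕ → ℕ → Prop) (h : ℕ → Fin l), IsGeneric E h := by
  classical
  have : Nonempty (Fin l) := ⟨⟨0, hl⟩⟩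
  obtain ⟨c, hc⟩ := exists_surjective_nat (Finset ℕ × Fin l)
  choose g hg using hc
  refine ⟨fun m n => (c m).2 < (c n).2 ∧ (m ∈ (c n).1 ∨ n ∈ (c m).1), fun n => (c n).2,
    fun R => ⟨fun u v huv => huv.1, fun m _ F _ P k => ?_⟩⟩
  -- Varying `j` gives infinitely many codes of a suitable neighbourhood in colour `k`; all but
  -- finitely many of them avoid `F` and the sets coded by the elements of `F`.
  let G : ℕ → ℕ := fun j => g (insert j (F.filter P), k)
  have hG : Set.InjOn G {j | j ∉ F} := by
    intro i hi j hj hij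
    have h1 : insert i (F.filter P) = insert j (F.filter P) := by
      have := congrArg c hij
      simp only [G, hg, Prod.mk.injEq, and_true] at this
      exact this
    have h2 : i ∈ insert j (F.filter P) := h1 ▸ Finset.mem_insert_self _ _
    rcases Finset.mem_insert.1 h2 with h3 | h3
    · exact h3
    · exact absurd (Finset.mem_filter.1 h3).1 hi
  have hinf : (G '' {j | j ∉ F}).Infinite :=
    Set.Infinite.image hG F.finite_toSet.infinite_compl
  obtain ⟨x, ⟨j, hj, rfl⟩, hx⟩ := hinf.exists_notMem_finset (F ∪ F.biUnion fun y => (c y).1)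
  simp only [Finset.mem_union, Finset.mem_biUnion, not_or, not_exists, not_and] at hx
  refine ⟨G j, hx.1, by simp [G, hg], fun y hy => ?_⟩
  have hyj : y ≠ j := fun h => hj (h ▸ hy)
  have hcj : c (G j) = (insert j (F.filter P), k) := hg _
  constructor
  · intro hlt
    simp [hcj, hlt, hy, hyj, hx.2 y hy]
  · intro hlt
    simp [hcj, hlt, hy, hyj, hx.2 y hy]

/-! ### Back and forth -/

/-- Two tuples of vertices of coloured digraphs that have the same colours and satisfy the same
atomic formulas. -/
structure Matched {ι : Type} (E : V → V → Prop) (h : V → Fin l) (E' : W → W → Prop)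
    (h' : W → Fin l) (a : ι → V) (b : ι → W) : Prop where
  color : ∀ i, h (a i) = h' (b i)
  eq_iff : ∀ i j, a i = a j ↔ b i = b j
  adj_iff : ∀ i j, E (a i) (a j) ↔ E' (b i) (b j)

theorem Matched.symm {ι : Type} {E : V → V → Prop} {h : V → Fin l} {E' : W → W → Prop}
    {h' : W → Fin l} {a : ι → V} {b : ι → W} (hab : Matched E h E' h' a b) :
    Matched E' h' E h b a :=
  ⟨fun i => (hab.color i).symm, fun i j => (hab.eq_iff i j).symm,
    fun i j => (hab.adj_iff i j).symm⟩

/-- The one-step extension property of matched tuples. -/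
theorem Matched.exists_match {ι : Type} [Finite ι] {E : V → V → Prop} {h : V → Fin l}
    {E' : W → W → Prop} {h' : W → Fin l} {a : ι → V} {b : ι → W} {R : ℕ}
    (hab : Matched E h E' h' a b) (hc : IsColoring E h) (hg : IsGenericUpTo E' h' R)
    (hR : Nat.card ι ≤ R) (w : V) :
    ∃ x, h w = h' x ∧ ∀ i, (a i = w ↔ b i = x) ∧ (E (a i) w ↔ E' (b i) x) ∧
      (E w (a i) ↔ E' x (b i)) := by
  classical
  by_cases hw : ∃ i, a i = w
  · obtain ⟨j, rfl⟩ := hw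
    exact ⟨b j, hab.color j, fun i => ⟨hab.eq_iff i j, hab.adj_iff i j, hab.adj_iff j i⟩⟩
  have := Fintype.ofFinite ι
  have hF : (Finset.univ.image b).card ≤ R :=
    Finset.card_image_le.trans (by rwa [Finset.card_univ, ← Nat.card_eq_fintype_card])
  obtain ⟨x, hxF, hx, hxa⟩ := hg.ext _ hF (Finset.univ.image b) rfl
    (fun y => ∃ i, b i = y ∧ (E (a i) w ∨ E w (a i))) (h w)
  refine ⟨x, hx.symm, fun i => ?_⟩
  have hP : (∃ j, b j = b i ∧ (E (a j) w ∨ E w (a j))) ↔ (E (a i) w ∨ E w (a i)) := by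
    refine ⟨?_, fun h => ⟨i, rfl, h⟩⟩
    rintro ⟨j, hj, h⟩
    rwa [← (hab.eq_iff j i).2 hj]
  obtain ⟨h1, h2⟩ := hxa (b i) (Finset.mem_image_of_mem b (Finset.mem_univ i))
  rw [hP, ← hab.color] at h1 h2
  have h3 := hc (a i) w
  have h4 := hc w (a i)
  have h5 := hg.isColoring (b i) x
  have h6 := hg.isColoring x (b i)
  rw [hx, ← hab.color] at h5 h6
  refine ⟨iff_of_false (fun h => hw ⟨i, h⟩) fun h => hxF ?_, ?_, ?_⟩
  · exact h ▸ Finset.mem_image_of_mem b (Finset.mem_univ i)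
  · by_cases hlt : h (a i) < h w
    · rw [h1 hlt]
      exact ⟨Or.inl, fun h => h.resolve_right fun h' => lt_asymm hlt (h4 h')⟩
    · exact iff_of_false (fun h => hlt (h3 h)) fun h => hlt (h5 h)
  · by_cases hlt : h w < h (a i)
    · rw [h2 hlt]
      exact ⟨Or.inr, fun h => h.resolve_left fun h' => lt_asymm hlt (h3 h')⟩
    · exact iff_of_false (fun h => hlt (h4 h)) fun h => hlt (h6 h)

/-- A finite relation between the vertices of two coloured digraphs that is a partial
isomorphism. -/
def IsPartialIso (E : V → V → Prop) (h : V → Fin l) (E' : W → W → Prop) (h' : W → Fin l)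
    (s : Finset (V × W)) : Prop :=
  Matched E h E' h' (fun p : s => p.1.1) (fun p : s => p.1.2)

theorem isPartialIso_insert [DecidableEq (V × W)] {E : V → V → Prop} {h : V → Fin l}
    {E' : W → W → Prop} {h' : W → Fin l} {s : Finset (V × W)} {w : V} {x : W}
    (hs : IsPartialIso E h E' h' s) (hc : IsColoring E h) (hc' : IsColoring E' h')
    (hwx : h w = h' x) (H : ∀ p ∈ s, (p.1 = w ↔ p.2 = x) ∧ (E p.1 w ↔ E' p.2 x) ∧
      (E w p.1 ↔ E' x p.2)) :
    IsPartialIso E h E' h' (insert (w, x) s) := by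
  refine ⟨?_, ?_, ?_⟩
  · rintro ⟨p, hp⟩
    rcases Finset.mem_insert.1 hp with rfl | hp
    · exact hwx
    · exact hs.color ⟨p, hp⟩
  · rintro ⟨p, hp⟩ ⟨q, hq⟩
    rcases Finset.mem_insert.1 hp with rfl | hp <;> rcases Finset.mem_insert.1 hq with rfl | hq
    · simp
    · simpa [eq_comm] using (H q hq).1
    · exact (H p hp).1
    · exact hs.eq_iff ⟨p, hp⟩ ⟨q, hq⟩
  · rintro ⟨p, hp⟩ ⟨q, hq⟩
    rcases Finset.mem_insert.1 hp with rfl | hp <;> rcases Finset.mem_insert.1 hq with rfl | hq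
    · exact iff_of_false (fun h => lt_irrefl _ (hc _ _ h)) fun h => lt_irrefl _ (hc' _ _ h)
    · exact (H q hq).2.2
    · exact (H p hp).2.1
    · exact hs.adj_iff ⟨p, hp⟩ ⟨q, hq⟩

theorem IsPartialIso.exists_forth [DecidableEq (V × W)] {E : V → V → Prop} {h : V → Fin l}
    {E' : W → W → Prop} {h' : W → Fin l} {s : Finset (V × W)}
    (hs : IsPartialIso E h E' h' s) (hc : IsColoring E h) (hg : IsGeneric E' h') (w : V) :
    ∃ x, IsPartialIso E h E' h' (insert (w, x) s) := by
  obtain ⟨x, hx, H⟩ := Matched.exists_match hs hc (hg (Nat.card s)) le_rfl w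
  exact ⟨x, isPartialIso_insert hs hc (hg 0).isColoring hx fun p hp => H ⟨p, hp⟩⟩

theorem IsPartialIso.exists_back [DecidableEq (V × W)] {E : V → V → Prop} {h : V → Fin l}
    {E' : W → W → Prop} {h' : W → Fin l} {s : Finset (V × W)}
    (hs : IsPartialIso E h E' h' s) (hg : IsGeneric E h) (hc' : IsColoring E' h') (x : W) :
    ∃ w, IsPartialIso E h E' h' (insert (w, x) s) := by
  obtain ⟨w, hw, H⟩ := Matched.exists_match (Matched.symm hs) hc' (hg (Nat.card s)) le_rfl x
  exact ⟨w, isPartialIso_insert hs (hg 0).isColoring hc' hw.symm fun p hp =>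
    ⟨(H ⟨p, hp⟩).1.symm, (H ⟨p, hp⟩).2.1.symm, (H ⟨p, hp⟩).2.2.symm⟩⟩

/-- A relation that meets countably many requirements and all of whose pairs of elements lie in
finite relations satisfying `P`, built by extending such finite relations step by step. -/
theorem exists_relation_of_extension [DecidableEq (V × W)] {ι : Type} [Countable ι]
    (P : Finset (V × W) → Prop) (h0 : P ∅) (D : ι → V × W → Prop)
    (hD : ∀ s, P s → ∀ i, ∃ p, D i p ∧ P (insert p s)) :
    ∃ S : Set (V × W), (∀ i, ∃ p ∈ S, D i p) ∧
      ∀ p ∈ S, ∀ q ∈ S, ∃ s, P s ∧ p ∈ s ∧ q ∈ s := by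
  cases nonempty_encodable ι
  let 𝒟 : ι → Order.Cofinal {s // P s} := fun i =>
    { carrier := {s | ∃ p ∈ s.1, D i p}
      isCofinal := fun s => by
        obtain ⟨p, hp, hps⟩ := hD s.1 s.2 i
        exact ⟨⟨_, hps⟩, ⟨p, Finset.mem_insert_self _ _, hp⟩, Finset.subset_insert _ _⟩ }
  let I := Order.idealOfCofinals (⟨∅, h0⟩ : {s // P s}) 𝒟
  refine ⟨{p | ∃ s ∈ I, p ∈ s.1}, fun i => ?_, ?_⟩
  · obtain ⟨s, ⟨p, hp, hpD⟩, hs⟩ := Order.cofinal_meets_idealOfCofinals ⟨∅, h0⟩ 𝒟 i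
    exact ⟨p, ⟨s, hs, hp⟩, hpD⟩
  · rintro p ⟨s, hs, hp⟩ q ⟨t, ht, hq⟩
    obtain ⟨u, -, hsu, htu⟩ := I.directed _ hs _ ht
    exact ⟨u.1, u.2, hsu hp, htu hq⟩

theorem isPartialIso_empty (E : V → V → Prop) (h : V → Fin l) (E' : W → W → Prop)
    (h' : W → Fin l) : IsPartialIso E h E' h' ∅ :=
  ⟨fun i => absurd i.2 (Finset.notMem_empty _), fun i => absurd i.2 (Finset.notMem_empty _),
    fun i => absurd i.2 (Finset.notMem_empty _)⟩

/-- Every countable coloured digraph embeds into every generic one. -/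
theorem IsGeneric.nonempty_embedding [Countable V] {E : V → V → Prop} {h : V → Fin l}
    {E' : W → W → Prop} {h' : W → Fin l} (hc : IsColoring E h) (hg : IsGeneric E' h') :
    Nonempty (E ↪r E') := by
  classical
  obtain ⟨S, hS, hSP⟩ := exists_relation_of_extension (IsPartialIso E h E' h')
    (isPartialIso_empty E h E' h') (fun (w : V) p => p.1 = w) fun s hs w => by
      obtain ⟨x, hx⟩ := hs.exists_forth hc hg w
      exact ⟨(w, x), rfl, hx⟩
  have hS' : ∀ w, ∃ x, (w, x) ∈ S := fun w => by
    obtain ⟨⟨_, x⟩, hp, rfl⟩ := hS w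
    exact ⟨x, hp⟩
  choose f hf using hS'
  refine ⟨⟨⟨f, fun u v huv => ?_⟩, fun {u v} => ?_⟩⟩
  · obtain ⟨s, hs, hu, hv⟩ := hSP _ (hf u) _ (hf v)
    exact (hs.eq_iff ⟨_, hu⟩ ⟨_, hv⟩).2 huv
  · obtain ⟨s, hs, hu, hv⟩ := hSP _ (hf u) _ (hf v)
    exact (hs.adj_iff ⟨_, hu⟩ ⟨_, hv⟩).symm

/-- Countable generic digraphs are isomorphic. -/
theorem IsGeneric.nonempty_relIso [Countable V] [Countable W] {E : V → V → Prop} {h : V → Fin l}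
    {E' : W → W → Prop} {h' : W → Fin l} (hg : IsGeneric E h) (hg' : IsGeneric E' h') :
    Nonempty (E ≃r E') := by
  classical
  obtain ⟨S, hS, hSP⟩ := exists_relation_of_extension (IsPartialIso E h E' h')
    (isPartialIso_empty E h E' h')
    (fun (i : V ⊕ W) p => Sum.elim (fun w => p.1 = w) (fun x => p.2 = x) i) fun s hs i => by
      rcases i with w | x
      · obtain ⟨x, hx⟩ := hs.exists_forth (hg 0).isColoring hg' w
        exact ⟨(w, x), rfl, hx⟩
      · obtain ⟨w, hw⟩ := hs.exists_back hg (hg' 0).isColoring x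
        exact ⟨(w, x), rfl, hw⟩
  have hS1 : ∀ w, ∃ x, (w, x) ∈ S := fun w => by
    obtain ⟨⟨_, x⟩, hp, rfl⟩ := hS (Sum.inl w)
    exact ⟨x, hp⟩
  have hS2 : ∀ x, ∃ w, (w, x) ∈ S := fun x => by
    obtain ⟨⟨w, _⟩, hp, rfl⟩ := hS (Sum.inr x)
    exact ⟨w, hp⟩
  have heq : ∀ p ∈ S, ∀ q ∈ S, p.1 = q.1 ↔ p.2 = q.2 := fun p hp q hq => by
    obtain ⟨s, hs, hp, hq⟩ := hSP p hp q hq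
    exact hs.eq_iff ⟨p, hp⟩ ⟨q, hq⟩
  choose f hf using hS1
  choose g hg using hS2
  refine ⟨⟨⟨f, g, fun w => (heq _ (hg (f w)) _ (hf w)).2 rfl,
    fun x => (heq _ (hf (g x)) _ (hg x)).1 rfl⟩, fun {u v} => ?_⟩⟩
  obtain ⟨s, hs, hu, hv⟩ := hSP _ (hf u) _ (hf v)
  exact (hs.adj_iff ⟨_, hu⟩ ⟨_, hv⟩).symm

end Relations


/-! ### Genericity and first-order formulas -/

section Formulas

open BoundedFormula

variable {l : ℕ}

/-- The edge relation of a structure in the language of digraphs. -/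
def edge (M : Type) [Language.graph.Structure M] (a b : M) : Prop :=
  Structure.RelMap adj ![a, b]

theorem term_eq_var {β : Type} : ∀ t : Language.graph.Term β, ∃ i, t = Term.var i
  | Term.var i => ⟨i, rfl⟩
  | Term.func f _ => isEmptyElim f

theorem relMap_adj_iff {M : Type} [Language.graph.Structure M] (x : Fin 2 → M) :
    Structure.RelMap adj x ↔ edge M (x 0) (x 1) := by
  have : x = ![x 0, x 1] := by ext i; fin_cases i <;> rfl
  rw [edge, ← this]

theorem Matched.snoc {V W α : Type} {n : ℕ} {E : V → V → Prop} {h : V → Fin l}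
    {E' : W → W → Prop} {h' : W → Fin l} {v : α → V} {xs : Fin n → V} {w : α → W}
    {ys : Fin n → W} (hm : Matched E h E' h' (Sum.elim v xs) (Sum.elim w ys))
    (hc : IsColoring E h) (hc' : IsColoring E' h') {a : V} {b : W} (hab : h a = h' b)
    (H : ∀ i, (Sum.elim v xs i = a ↔ Sum.elim w ys i = b) ∧
      (E (Sum.elim v xs i) a ↔ E' (Sum.elim w ys i) b) ∧
      (E a (Sum.elim v xs i) ↔ E' b (Sum.elim w ys i))) :
    Matched E h E' h' (Sum.elim v (Fin.snoc xs a : Fin (n + 1) → V))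
      (Sum.elim w (Fin.snoc ys b : Fin (n + 1) → W)) := by
  -- Every index of the longer tuple is either the new one or an index of the old tuple.
  have key : ∀ i : α ⊕ Fin (n + 1),
      (Sum.elim v (Fin.snoc xs a : Fin (n + 1) → V) i = a ∧
        Sum.elim w (Fin.snoc ys b : Fin (n + 1) → W) i = b) ∨
      ∃ j : α ⊕ Fin n, Sum.elim v (Fin.snoc xs a : Fin (n + 1) → V) i = Sum.elim v xs j ∧
        Sum.elim w (Fin.snoc ys b : Fin (n + 1) → W) i = Sum.elim w ys j := by
    rintro (i | i)
    · exact Or.inr ⟨Sum.inl i, rfl, rfl⟩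
    · induction i using Fin.lastCases with
      | last => exact Or.inl ⟨by simp, by simp⟩
      | cast i => exact Or.inr ⟨Sum.inr i, by simp, by simp⟩
  refine ⟨fun i => ?_, fun i j => ?_, fun i j => ?_⟩
  · rcases key i with ⟨h1, h2⟩ | ⟨i', h1, h2⟩ <;> rw [h1, h2]
    · exact hab
    · exact hm.color i'
  · rcases key i with ⟨h1, h2⟩ | ⟨i', h1, h2⟩ <;> rcases key j with ⟨h3, h4⟩ | ⟨j', h3, h4⟩ <;>
      rw [h1, h2, h3, h4]
    · simp
    · rw [eq_comm, (H j').1, eq_comm]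
    · exact (H i').1
    · exact hm.eq_iff i' j'
  · rcases key i with ⟨h1, h2⟩ | ⟨i', h1, h2⟩ <;> rcases key j with ⟨h3, h4⟩ | ⟨j', h3, h4⟩ <;>
      rw [h1, h2, h3, h4]
    · exact iff_of_false (fun h => lt_irrefl _ (hc _ _ h)) fun h => lt_irrefl _ (hc' _ _ h)
    · exact (H j').2.2
    · exact (H i').2.1
    · exact hm.adj_iff i' j'

/-- A formula cannot distinguish matched tuples of coloured digraphs that are sufficiently
generic. -/
theorem exists_genericity_bound (l : ℕ) {α : Type} [Finite α] {n : ℕ}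
    (φ : Language.graph.BoundedFormula α n) :
    ∃ R : ℕ, ∀ (M N : Type) [Language.graph.Structure M] [Language.graph.Structure N]
      (h : M → Fin l) (h' : N → Fin l), IsGenericUpTo (edge M) h R → IsGenericUpTo (edge N) h' R →
      ∀ (v : α → M) (xs : Fin n → M) (w : α → N) (ys : Fin n → N),
        Matched (edge M) h (edge N) h' (Sum.elim v xs) (Sum.elim w ys) →
        (φ.Realize v xs ↔ φ.Realize w ys) := by
  induction φ with
  | falsum => exact ⟨0, fun _ _ _ _ _ _ _ _ _ _ _ _ _ => Iff.rfl⟩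
  | equal t₁ t₂ =>
    refine ⟨0, fun _ _ _ _ _ _ _ _ v xs w ys hm => ?_⟩
    obtain ⟨i, rfl⟩ := term_eq_var t₁
    obtain ⟨j, rfl⟩ := term_eq_var t₂
    exact hm.eq_iff i j
  | rel r ts =>
    refine ⟨0, fun _ _ _ _ _ _ _ _ v xs w ys hm => ?_⟩
    cases r
    obtain ⟨i, hi⟩ := term_eq_var (ts 0)
    obtain ⟨j, hj⟩ := term_eq_var (ts 1)
    simp only [BoundedFormula.Realize]
    rw [relMap_adj_iff, relMap_adj_iff, hi, hj]
    exact hm.adj_iff i j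
  | imp φ ψ ihφ ihψ =>
    obtain ⟨R, hR⟩ := ihφ
    obtain ⟨S, hS⟩ := ihψ
    refine ⟨max R S, fun M N _ _ h h' hg hg' v xs w ys hm => ?_⟩
    rw [realize_imp, realize_imp,
      hR M N h h' (hg.mono (le_max_left _ _)) (hg'.mono (le_max_left _ _)) v xs w ys hm,
      hS M N h h' (hg.mono (le_max_right _ _)) (hg'.mono (le_max_right _ _)) v xs w ys hm]
  | @all n φ ih =>
    obtain ⟨R, hR⟩ := ih
    refine ⟨max R (Nat.card (α ⊕ Fin n)), fun M N _ _ h h' hg hg' v xs w ys hm => ?_⟩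
    have hφ := hR M N h h' (hg.mono (le_max_left _ _)) (hg'.mono (le_max_left _ _))
    rw [realize_all, realize_all]
    constructor
    · intro H b
      obtain ⟨a, ha, Ha⟩ := hm.symm.exists_match hg'.isColoring (hg.mono (le_max_right _ _))
        le_rfl b
      exact (hφ _ _ _ _ (hm.snoc hg.isColoring hg'.isColoring ha.symm fun i =>
        ⟨(Ha i).1.symm, (Ha i).2.1.symm, (Ha i).2.2.symm⟩)).1 (H a)
    · intro H a
      obtain ⟨b, hb, Hb⟩ := hm.exists_match hg.isColoring (hg'.mono (le_max_right _ _))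
        le_rfl a
      exact (hφ _ _ _ _ (hm.snoc hg.isColoring hg'.isColoring hb Hb)).2 (H b)

theorem matched_of_isEmpty {ι V W : Type} [IsEmpty ι] (E : V → V → Prop) (h : V → Fin l)
    (E' : W → W → Prop) (h' : W → Fin l) (a : ι → V) (b : ι → W) : Matched E h E' h' a b :=
  ⟨isEmptyElim, isEmptyElim, isEmptyElim⟩

/-- A sentence has the same truth value in all sufficiently generic digraphs. -/
theorem exists_genericity_bound_sentence (l : ℕ) (φ : Language.graph.Sentence) :
    ∃ R : ℕ, ∀ (M N : Type) [Language.graph.Structure M] [Language.graph.Structure N]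
      (h : M → Fin l) (h' : N → Fin l), IsGenericUpTo (edge M) h R → IsGenericUpTo (edge N) h' R →
      (M ⊨ φ ↔ N ⊨ φ) := by
  obtain ⟨R, hR⟩ := exists_genericity_bound l φ
  exact ⟨R, fun M N _ _ h h' hg hg' => hR M N h h' hg hg' _ _ _ _ (matched_of_isEmpty _ _ _ _ _ _)⟩

/-! ### Uniformly definable relations -/

/-- A relation on `n`-tuples, given on all digraphs simultaneously, that is defined by one
formula. -/
def IsDefinable (n : ℕ) (P : ∀ (M : Type) [Language.graph.Structure M], (Fin n → M) → Prop) :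
    Prop :=
  ∃ φ : Language.graph.BoundedFormula Empty n,
    ∀ (M : Type) [Language.graph.Structure M] (xs : Fin n → M), φ.Realize default xs ↔ P M xs

namespace IsDefinable

variable {n : ℕ} {P Q : ∀ (M : Type) [Language.graph.Structure M], (Fin n → M) → Prop}

theorem const (c : Prop) : IsDefinable n fun _ _ _ => c := by
  by_cases hc : c
  · exact ⟨⊤, fun M _ xs => by simp [hc]⟩
  · exact ⟨⊥, fun M _ xs => by simp [hc]⟩

theorem eq (i j : Fin n) : IsDefinable n fun _ _ xs => xs i = xs j :=
  ⟨Term.bdEqual (&i) (&j), fun M _ xs => by simp⟩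

theorem edge (i j : Fin n) : IsDefinable n fun M _ xs => edge M (xs i) (xs j) :=
  ⟨adj.boundedFormula₂ (&i) (&j), fun M _ xs => by simp [AlmostSure.edge]⟩

theorem not (hP : IsDefinable n P) : IsDefinable n fun M _ xs => ¬ P M xs := by
  obtain ⟨φ, hφ⟩ := hP
  exact ⟨∼φ, fun M _ xs => by simp [hφ]⟩

theorem and (hP : IsDefinable n P) (hQ : IsDefinable n Q) :
    IsDefinable n fun M _ xs => P M xs ∧ Q M xs := by
  obtain ⟨φ, hφ⟩ := hP
  obtain ⟨ψ, hψ⟩ := hQ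
  exact ⟨φ ⊓ ψ, fun M _ xs => by simp [hφ, hψ]⟩

theorem imp (hP : IsDefinable n P) (hQ : IsDefinable n Q) :
    IsDefinable n fun M _ xs => P M xs → Q M xs := by
  obtain ⟨φ, hφ⟩ := hP
  obtain ⟨ψ, hψ⟩ := hQ
  exact ⟨φ.imp ψ, fun M _ xs => by simp [hφ, hψ]⟩

theorem iff (hP : IsDefinable n P) (hQ : IsDefinable n Q) :
    IsDefinable n fun M _ xs => P M xs ↔ Q M xs := by
  simpa only [iff_def] using (hP.imp hQ).and (hQ.imp hP)

theorem forall_finite {ι : Type} [Finite ι]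
    {P : ι → ∀ (M : Type) [Language.graph.Structure M], (Fin n → M) → Prop}
    (hP : ∀ i, IsDefinable n (P i)) : IsDefinable n fun M _ xs => ∀ i, P i M xs := by
  choose φ hφ using hP
  exact ⟨iInf φ, fun M _ xs => by simp [hφ]⟩

theorem exists_finite {ι : Type} [Finite ι]
    {P : ι → ∀ (M : Type) [Language.graph.Structure M], (Fin n → M) → Prop}
    (hP : ∀ i, IsDefinable n (P i)) : IsDefinable n fun M _ xs => ∃ i, P i M xs := by
  choose φ hφ using hP
  exact ⟨iSup φ, fun M _ xs => by simp [hφ]⟩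

theorem ex {P : ∀ (M : Type) [Language.graph.Structure M], (Fin n → M) → M → Prop}
    (hP : IsDefinable (n + 1) fun M _ ys => P M (fun i => ys i.castSucc) (ys (Fin.last n))) :
    IsDefinable n fun M _ xs => ∃ x, P M xs x := by
  obtain ⟨φ, hφ⟩ := hP
  exact ⟨φ.ex, fun M _ xs => by simp [hφ]⟩

theorem inWalk : ∀ (k : ℕ) {n : ℕ} (i : Fin n),
    IsDefinable n fun M _ xs => InWalk (AlmostSure.edge M) k (xs i)
  | 0, _, _ => const True
  | k + 1, _, i => ex (P := fun M _ xs x => AlmostSure.edge M x (xs i) ∧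
      InWalk (AlmostSure.edge M) k x) ((edge _ _).and (inWalk k _))

theorem inWalk_flip : ∀ (k : ℕ) {n : ℕ} (i : Fin n),
    IsDefinable n fun M _ xs => InWalk (flip (AlmostSure.edge M)) k (xs i)
  | 0, _, _ => const True
  | k + 1, _, i => ex (P := fun M _ xs x => AlmostSure.edge M (xs i) x ∧
      InWalk (flip (AlmostSure.edge M)) k x) ((edge _ _).and (inWalk_flip k _))

theorem hasLevel (l k : ℕ) (i : Fin n) :
    IsDefinable n fun M _ xs => HasLevel (AlmostSure.edge M) l k (xs i) :=
  (inWalk k i).and (inWalk_flip _ i)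

/-- If a definable relation holds for all tuples of a structure, it does so in all models of the
theory of that structure. -/
theorem forall_of_model (hP : IsDefinable n P) (M N : Type) [Language.graph.Structure M]
    [Language.graph.Structure N] [N ⊨ Language.graph.completeTheory M] (hM : ∀ xs, P M xs) :
    ∀ xs, P N xs := by
  obtain ⟨φ, hφ⟩ := hP
  have h1 : M ⊨ φ.alls := by
    rw [Sentence.Realize, realize_alls]
    exact fun xs => (hφ M xs).2 (hM xs)
  have h2 := (realize_iff_of_model_completeTheory M N φ.alls).2 h1
  rw [Sentence.Realize, realize_alls] at h2
  exact fun xs => (hφ N xs).1 (h2 xs)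

theorem iff_of_elementary (hP : IsDefinable n P) {M N : Type} [Language.graph.Structure M]
    [Language.graph.Structure N] (f : M ↪ₑ[Language.graph] N) (xs : Fin n → M) :
    P N (f ∘ xs) ↔ P M xs := by
  obtain ⟨φ, hφ⟩ := hP
  rw [← hφ, ← hφ, ← f.map_boundedFormula, Subsingleton.elim (f ∘ default) default]

end IsDefinable

/-! ### Definability of genericity -/

/-- A first-order version of the instance of the extension property for the tuple `y`, the pattern
`p` and the colour `k`, in which colours are described by walks. -/
def HasWitness {V : Type} {m : ℕ} (E : V → V → Prop) (k : Fin l) (p : Fin m → Prop)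
    (y : Fin m → V) : Prop :=
  ∃ x, (∀ i, ¬ y i = x) ∧ HasLevel E l k x ∧ ∀ (i : Fin m) (j : Fin l), HasLevel E l j (y i) →
    (j < k → (E (y i) x ↔ ∃ i', y i' = y i ∧ p i')) ∧
      (k < j → (E x (y i) ↔ ∃ i', y i' = y i ∧ p i'))

theorem isDefinable_hasWitness {m : ℕ} (k : Fin l) (p : Fin m → Prop) :
    IsDefinable m fun M _ y => HasWitness (edge M) k p y := by
  have hp : ∀ i : Fin m, IsDefinable (m + 1) fun M _ ys =>
      ∃ i', ys (Fin.castSucc i') = ys (Fin.castSucc i) ∧ p i' := fun i =>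
    .exists_finite fun i' => (IsDefinable.eq _ _).and (.const _)
  refine IsDefinable.ex (P := fun M _ y x => (∀ i, ¬ y i = x) ∧ HasLevel (edge M) l k x ∧
    ∀ (i : Fin m) (j : Fin l), HasLevel (edge M) l j (y i) →
    (j < k → (edge M (y i) x ↔ ∃ i', y i' = y i ∧ p i')) ∧
      (k < j → (edge M x (y i) ↔ ∃ i', y i' = y i ∧ p i'))) ?_
  exact (IsDefinable.forall_finite fun i => (IsDefinable.eq _ _).not).and
    ((IsDefinable.hasLevel _ _ _).and (.forall_finite fun i => .forall_finite fun j =>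
      (IsDefinable.hasLevel _ _ _).imp (((IsDefinable.const _).imp ((IsDefinable.edge _ _).iff
        (hp i))).and ((IsDefinable.const _).imp ((IsDefinable.edge _ _).iff (hp i))))))

theorem IsGeneric.hasLevel {V : Type} {E : V → V → Prop} {h : V → Fin l} (hg : IsGeneric E h)
    (v : V) : HasLevel E l (h v) v :=
  Extends.hasLevel ((hg 1).ext 1 le_rfl) v

theorem IsGeneric.hasWitness {V : Type} {m : ℕ} {E : V → V → Prop} {h : V → Fin l}
    (hg : IsGeneric E h) (k : Fin l) (p : Fin m → Prop) (y : Fin m → V) :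
    HasWitness E k p y := by
  classical
  obtain ⟨x, hxF, hx, H⟩ := (hg _).ext _ le_rfl (Finset.univ.image y) rfl
    (fun v => ∃ i', y i' = v ∧ p i') k
  refine ⟨x, fun i hi => hxF (hi ▸ Finset.mem_image_of_mem y (Finset.mem_univ i)),
    hx ▸ hg.hasLevel x, fun i j hj => ?_⟩
  obtain rfl : h (y i) = j := Fin.ext ((hg 0).isColoring.eq_of_hasLevel hj)
  exact H _ (Finset.mem_image_of_mem y (Finset.mem_univ i))

theorem isGeneric_of_hasWitness {V : Type} {E : V → V → Prop} {h : V → Fin l}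
    (hc : IsColoring E h) (hlev : ∀ v, HasLevel E l (h v) v)
    (H : ∀ (m : ℕ) (k : Fin l) (p : Fin m → Prop) (y : Fin m → V), HasWitness E k p y) :
    IsGeneric E h := by
  refine fun R => ⟨hc, fun m _ F hF P k => ?_⟩
  let e := F.equivFinOfCardEq hF
  obtain ⟨x, hx, hxk, hxy⟩ := H m k (fun i => P (e.symm i)) (fun i => e.symm i)
  refine ⟨x, fun hxF => hx (e ⟨x, hxF⟩) (by simp), Fin.ext (hc.eq_of_hasLevel hxk), fun y hy => ?_⟩
  have hP : (∃ i', (e.symm i' : V) = y ∧ P (e.symm i')) ↔ P y :=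
    ⟨fun ⟨i', h1, h2⟩ => h1 ▸ h2, fun h => ⟨e ⟨y, hy⟩, by simp, by simpa using h⟩⟩
  have := hxy (e ⟨y, hy⟩) (h y) (by simpa using hlev y)
  simpa only [Equiv.symm_apply_apply, hP] using this

/-- Every digraph with the first-order theory of a generic digraph is generic. -/
theorem IsGeneric.of_model_completeTheory {M : Type} [Language.graph.Structure M]
    {h : M → Fin l} (hg : IsGeneric (edge M) h) (N : Type) [Language.graph.Structure N]
    [N ⊨ Language.graph.completeTheory M] : ∃ h' : N → Fin l, IsGeneric (edge N) h' := by
  have h1 : ∀ x : N, ¬ InWalk (edge N) l x := fun x =>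
    (IsDefinable.inWalk (n := 1) l 0).not.forall_of_model M N
      (fun xs hxs => ((hg 0).isColoring.le_of_inWalk hxs).not_gt (h _).isLt) ![x]
  obtain ⟨h', hc⟩ := exists_isColoring h1
  have h2 : ∀ x : N, ∃ k : Fin l, HasLevel (edge N) l k x := fun x =>
    (IsDefinable.exists_finite fun k : Fin l =>
      IsDefinable.hasLevel (n := 1) l k 0).forall_of_model M N
      (fun xs => ⟨_, hg.hasLevel (xs 0)⟩) ![x]
  refine ⟨h', isGeneric_of_hasWitness hc (fun v => ?_) fun m k p =>
    (isDefinable_hasWitness k p).forall_of_model M N (hg.hasWitness k p)⟩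
  obtain ⟨k, hk⟩ := h2 v
  rwa [hc.eq_of_hasLevel hk]

/-- If a generic digraph lies between `N` and an elementary extension of `N` that has a colouring,
then `N` is generic. -/
theorem IsGeneric.of_elementary {V N K : Type} [Language.graph.Structure N]
    [Language.graph.Structure K] {E : V → V → Prop} {h : V → Fin l} (hg : IsGeneric E h)
    (i : edge N ↪r E) (j : E ↪r edge K) (f : N ↪ₑ[Language.graph] K) (hf : ∀ x, f x = j (i x))
    {g : K → Fin l} (hc : IsColoring (edge K) g) :
    IsGeneric (edge N) fun x => h (i x) := by
  have hlevK : ∀ v, HasLevel (edge K) l (h v) (j v) := fun v =>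
    (hg.hasLevel v).map j fun _ _ => j.map_rel_iff.2
  refine isGeneric_of_hasWitness (fun u v huv => (hg 0).isColoring _ _ (i.map_rel_iff.2 huv))
    (fun v => ?_) fun m k p y => ?_
  · have h1 := (IsDefinable.hasLevel (n := 1) l (h (i v)) 0).iff_of_elementary f ![v]
    refine h1.1 ?_
    simpa [hf] using hlevK (i v)
  · refine ((isDefinable_hasWitness k p).iff_of_elementary f y).1 ?_
    obtain ⟨x, hx, hxk, H⟩ := hg.hasWitness k p fun a => i (y a)
    have hy : (f ∘ y) = fun a => j (i (y a)) := funext fun a => hf (y a)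
    rw [hy]
    refine ⟨j x, fun a ha => hx a (j.injective ha), hxk.map j fun _ _ => j.map_rel_iff.2,
      fun a c hac => ?_⟩
    -- The level of `j (i (y a))` in `K` is its colour, and `j` preserves colours.
    have hca : c = h (i (y a)) := Fin.ext
      ((hc.eq_of_hasLevel hac).symm.trans (hc.eq_of_hasLevel (hlevK _)))
    simpa only [j.map_rel_iff, j.injective.eq_iff] using H a c (hca ▸ hg.hasLevel _)

end Formulas


/-! ### The theory of the digraphs with a colouring -/

section Companions

open BoundedFormula

variable {l : ℕ}

/-- An embedding of digraphs as an embedding of structures. -/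
def embeddingOfEdge {M N : Type} [Language.graph.Structure M] [Language.graph.Structure N]
    (f : edge M ↪r edge N) : M ↪[Language.graph] N where
  toFun := f
  inj' := f.injective
  map_fun' g := isEmptyElim g
  map_rel' r x := by
    cases r
    exact (relMap_adj_iff _).trans (f.map_rel_iff.trans (relMap_adj_iff _).symm)

/-- An isomorphism of digraphs as an isomorphism of structures. -/
def equivOfEdge {M N : Type} [Language.graph.Structure M] [Language.graph.Structure N]
    (f : edge M ≃r edge N) : M ≃[Language.graph] N where
  toEquiv := f.toEquiv
  map_fun' g := isEmptyElim g
  map_rel' r x := by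
    cases r
    exact (relMap_adj_iff _).trans (f.map_rel_iff.trans (relMap_adj_iff _).symm)

/-- A homomorphism of digraphs as a homomorphism of structures. -/
def homOfEdge {M N : Type} [Language.graph.Structure M] [Language.graph.Structure N]
    (f : edge M →r edge N) : M →[Language.graph] N where
  toFun := f
  map_fun' g := isEmptyElim g
  map_rel' r x hx := by
    cases r
    exact (relMap_adj_iff _).2 (f.map_rel ((relMap_adj_iff _).1 hx))

theorem edge_map_iff {M N : Type} [Language.graph.Structure M] [Language.graph.Structure N]
    (f : M ↪[Language.graph] N) (a b : M) : edge N (f a) (f b) ↔ edge M a b := by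
  have := f.map_rel adj ![a, b]
  rw [relMap_adj_iff, relMap_adj_iff] at this
  exact this

theorem IsConjAtomic.realize_hom {α : Type} {n : ℕ} {φ : Language.graph.BoundedFormula α n}
    (hφ : IsConjAtomic φ) {M N : Type} [Language.graph.Structure M] [Language.graph.Structure N]
    (f : M →[Language.graph] N) (v : α → M) (xs : Fin n → M) (h : φ.Realize v xs) :
    φ.Realize (f ∘ v) (f ∘ xs) := by
  induction hφ with
  | top => simp
  | bot => exact h.elim
  | atomic ha =>
    cases ha with
    | equal t₁ t₂ =>
      simp only [realize_bdEqual, ← Sum.comp_elim, HomClass.realize_term] at h ⊢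
      rw [h]
    | rel R ts =>
      simp only [realize_rel, ← Sum.comp_elim, HomClass.realize_term] at h ⊢
      exact HomClass.map_rel f R _ h
  | inf _ _ ih₁ ih₂ =>
    rw [realize_inf] at h ⊢
    exact ⟨ih₁ h.1, ih₂ h.2⟩

/-- Primitive positive formulas are preserved by homomorphisms. -/
theorem IsPrimitivePositive.realize_hom {α : Type} {n : ℕ}
    {φ : Language.graph.BoundedFormula α n} (hφ : IsPrimitivePositive φ) {M N : Type}
    [Language.graph.Structure M] [Language.graph.Structure N] (f : M →[Language.graph] N)
    (v : α → M) (xs : Fin n → M) (h : φ.Realize v xs) : φ.Realize (f ∘ v) (f ∘ xs) := by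
  induction hφ with
  | conj hc => exact hc.realize_hom f v xs h
  | ex _ ih =>
    rw [realize_ex] at h ⊢
    obtain ⟨a, ha⟩ := h
    exact ⟨f a, by rw [← Fin.comp_snoc]; exact ih _ ha⟩

/-- The conjunction of the atomic formulas saying that `x₀, …, x_k` is a walk. -/
noncomputable def walkFormula (k : ℕ) : Language.graph.BoundedFormula Empty (k + 1) :=
  iInf fun i : Fin k => adj.boundedFormula₂ (&i.castSucc) (&i.succ)

theorem realize_walkFormula {k : ℕ} {M : Type} [Language.graph.Structure M]
    (xs : Fin (k + 1) → M) :
    (walkFormula k).Realize default xs ↔ ∀ i : Fin k, edge M (xs i.castSucc) (xs i.succ) := by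
  simp [walkFormula, edge]

theorem inWalk_iff_exists_tuple {V : Type} {E : V → V → Prop} (k : ℕ) (v : V) :
    InWalk E k v ↔ ∃ xs : Fin (k + 1) → V, xs (Fin.last k) = v ∧
      ∀ i : Fin k, E (xs i.castSucc) (xs i.succ) := by
  induction k generalizing v with
  | zero => exact ⟨fun _ => ⟨fun _ => v, rfl, fun i => i.elim0⟩, fun _ => trivial⟩
  | succ k ih =>
    constructor
    · rintro ⟨u, huv, hu⟩
      obtain ⟨xs, rfl, hxs⟩ := (ih u).1 hu
      refine ⟨Fin.snoc xs v, by simp, fun i => ?_⟩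
      induction i using Fin.lastCases with
      | last => simpa using huv
      | cast i => simpa only [Fin.succ_castSucc, Fin.snoc_castSucc] using hxs i
    · rintro ⟨xs, rfl, hxs⟩
      refine ⟨xs (Fin.last k).castSucc, hxs (Fin.last k), (ih _).2
        ⟨fun i => xs i.castSucc, rfl, fun i => ?_⟩⟩
      simpa only [Fin.succ_castSucc] using hxs i.castSucc

theorem isConjAtomic_foldr {α : Type} {n : ℕ} :
    ∀ L : List (Language.graph.BoundedFormula α n), (∀ φ ∈ L, φ.IsAtomic) →
      IsConjAtomic (L.foldr (· ⊓ ·) ⊤)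
  | [], _ => .top
  | φ :: L, h => .inf (.atomic (h φ List.mem_cons_self))
      (isConjAtomic_foldr L fun ψ hψ => h ψ (List.mem_cons_of_mem _ hψ))

theorem isQF_foldr {α : Type} {n : ℕ} :
    ∀ L : List (Language.graph.BoundedFormula α n), (∀ φ ∈ L, φ.IsQF) →
      (L.foldr (· ⊓ ·) ⊤).IsQF
  | [], _ => IsQF.top
  | φ :: L, h => (h φ List.mem_cons_self).inf
      (isQF_foldr L fun ψ hψ => h ψ (List.mem_cons_of_mem _ hψ))

theorem isQF_iInf {α β : Type} [Finite β] {n : ℕ}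
    {f : β → Language.graph.BoundedFormula α n} (hf : ∀ b, (f b).IsQF) : (iInf f).IsQF := by
  refine isQF_foldr _ fun φ hφ => ?_
  obtain ⟨b, -, rfl⟩ := List.mem_map.1 hφ
  exact hf b

theorem isConjAtomic_walkFormula (k : ℕ) : IsConjAtomic (walkFormula k) := by
  refine isConjAtomic_foldr _ fun φ hφ => ?_
  obtain ⟨b, -, rfl⟩ := List.mem_map.1 hφ
  exact .rel _ _

theorem IsPrimitivePositive.exs {α : Type} :
    ∀ {n : ℕ} {φ : Language.graph.BoundedFormula α n}, IsPrimitivePositive φ →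
      IsPrimitivePositive φ.exs
  | 0, _, h => h
  | _ + 1, φ, h => IsPrimitivePositive.exs (φ := φ.ex) (.ex h)

theorem isUniversal_alls {α : Type} :
    ∀ {n : ℕ} {φ : Language.graph.BoundedFormula α n}, φ.IsUniversal → φ.alls.IsUniversal
  | 0, _, h => h
  | _ + 1, φ, h => isUniversal_alls (φ := φ.all) (.all h)

theorem sentence_realize_alls {M : Type} [Language.graph.Structure M] {n : ℕ}
    (φ : Language.graph.BoundedFormula Empty n) :
    M ⊨ φ.alls ↔ ∀ xs : Fin n → M, φ.Realize default xs :=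
  realize_alls

theorem sentence_realize_exs {M : Type} [Language.graph.Structure M] {n : ℕ}
    (φ : Language.graph.BoundedFormula Empty n) :
    M ⊨ φ.exs ↔ ∃ xs : Fin n → M, φ.Realize default xs :=
  realize_exs

/-- The universal sentence saying that there is no walk with `l` edges. -/
noncomputable def noWalkSentence (l : ℕ) : Language.graph.Sentence :=
  (∼(walkFormula l)).alls

theorem isUniversal_noWalkSentence (l : ℕ) : (noWalkSentence l).IsUniversal :=
  isUniversal_alls (IsUniversal.of_isQF (isQF_iInf fun _ => (IsAtomic.rel _ _).isQF).not)

theorem realize_noWalkSentence {M : Type} [Language.graph.Structure M] :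
    M ⊨ noWalkSentence l ↔ ∃ h : M → Fin l, IsColoring (edge M) h := by
  rw [noWalkSentence, sentence_realize_alls]
  simp only [realize_not, realize_walkFormula]
  constructor
  · refine fun H => exists_isColoring fun v hv => ?_
    obtain ⟨xs, -, hxs⟩ := (inWalk_iff_exists_tuple l v).1 hv
    exact H xs hxs
  · rintro ⟨h, hc⟩ xs hxs
    exact (hc.le_of_inWalk ((inWalk_iff_exists_tuple l _).2 ⟨xs, rfl, hxs⟩)).not_gt (h _).isLt

/-- The models of the theory `ppTheory T_l` are the digraphs with a homomorphism to `T_l`. -/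
theorem model_ppTheory_iff {M : Type} [Language.graph.Structure M] :
    M ⊨ ppTheory (transitiveTournament l) ↔ ∃ h : M → Fin l, IsColoring (edge M) h := by
  let := toStructure (transitiveTournament l)
  have hT : ∀ a b : Fin l, edge (Fin l) a b ↔ a < b := fun a b => Iff.rfl
  constructor
  · intro hM
    have h1 : ¬ (Fin l ⊨ (walkFormula l).exs) := by
      rw [sentence_realize_exs]
      rintro ⟨xs, hxs⟩
      exact (IsColoring.le_of_inWalk (h := id) (fun a b => (hT a b).1)
        ((inWalk_iff_exists_tuple l _).2 ⟨xs, rfl, (realize_walkFormula xs).1 hxs⟩)).not_gt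
        (Fin.isLt _)
    have h2 : M ⊨ ∼(walkFormula l).exs := hM.realize_of_mem _
      ⟨_, (IsPrimitivePositive.conj (isConjAtomic_walkFormula l)).exs,
        (Sentence.realize_not _).2 h1, rfl⟩
    rw [Sentence.realize_not, sentence_realize_exs] at h2
    refine exists_isColoring fun v hv => h2 ?_
    obtain ⟨xs, -, hxs⟩ := (inWalk_iff_exists_tuple l v).1 hv
    exact ⟨xs, (realize_walkFormula xs).2 hxs⟩
  · rintro ⟨h, hc⟩
    refine ⟨?_⟩
    rintro _ ⟨φ, hφ, hφT, rfl⟩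
    rw [Sentence.realize_not]
    intro hM
    refine (Sentence.realize_not _).1 hφT ?_
    have := hφ.realize_hom (homOfEdge (M := M) (N := Fin l) ⟨h, fun {a b} hab => hc a b hab⟩)
      default default hM
    rwa [Subsingleton.elim (_ ∘ (default : Empty → M)) default,
      Subsingleton.elim (_ ∘ (default : Fin 0 → M)) default] at this

/-! ### Model companions -/

/-- The quantifier-free diagram of a finite tuple `a`. -/
noncomputable def diagramFormula {U : Type} [Language.graph.Structure U] {n : ℕ} (a : Fin n → U) :
    Language.graph.BoundedFormula Empty n :=
  open Classical in
  iInf fun p : Fin n × Fin n =>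
    (if a p.1 = a p.2 then Term.bdEqual (&p.1) (&p.2) else ∼(Term.bdEqual (&p.1) (&p.2))) ⊓
    (if edge U (a p.1) (a p.2) then adj.boundedFormula₂ (&p.1) (&p.2)
      else ∼(adj.boundedFormula₂ (&p.1) (&p.2)))

theorem isQF_diagramFormula {U : Type} [Language.graph.Structure U] {n : ℕ} (a : Fin n → U) :
    (diagramFormula a).IsQF := by
  refine isQF_iInf fun p => IsQF.inf ?_ ?_
  · split_ifs
    · exact (IsAtomic.equal _ _).isQF
    · exact (IsAtomic.equal _ _).isQF.not
  · split_ifs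
    · exact (IsAtomic.rel _ _).isQF
    · exact (IsAtomic.rel _ _).isQF.not

theorem realize_diagramFormula {U M : Type} [Language.graph.Structure U]
    [Language.graph.Structure M] {n : ℕ} (a : Fin n → U) (b : Fin n → M) :
    (diagramFormula a).Realize default b ↔
      ∀ i j, (b i = b j ↔ a i = a j) ∧ (edge M (b i) (b j) ↔ edge U (a i) (a j)) := by
  simp only [diagramFormula, realize_iInf, realize_inf, Prod.forall]
  refine forall_congr' fun i => forall_congr' fun j => and_congr ?_ ?_
  · split_ifs with h <;> simp [h]
  · split_ifs with h
    · rw [iff_true_right h]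
      simp [edge]
    · rw [iff_false_right h]
      simp [edge]

/-- A structure that satisfies all universal consequences of `T` embeds into a model of `T`, namely
into an ultraproduct of models of `T` that contain the finite substructures. -/
theorem exists_embedding_of_universal {T : Language.graph.Theory} {U : Type}
    [Language.graph.Structure U] [Nonempty U]
    (hU : ∀ φ : Language.graph.Sentence, φ.IsUniversal → (T ⊨ᵇ φ) → U ⊨ φ) :
    ∃ N : Theory.ModelType.{0, 0, 0} T, Nonempty (U ↪[Language.graph] N) := by
  classical
  have hfin : ∀ A : Finset U, ∃ (N : Theory.ModelType.{0, 0, 0} T) (g : U → N), ∀ a ∈ A, ∀ b ∈ A,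
      (g a = g b ↔ a = b) ∧ (edge N (g a) (g b) ↔ edge U a b) := by
    intro A
    let e := A.equivFin
    let a : Fin A.card → U := fun i => e.symm i
    have h1 : ¬ (T ⊨ᵇ (∼(diagramFormula a)).alls) := by
      intro h
      have h2 := hU _ (isUniversal_alls (IsUniversal.of_isQF (isQF_diagramFormula a).not)) h
      rw [sentence_realize_alls] at h2
      exact h2 a ((realize_diagramFormula a a).2 fun _ _ => ⟨Iff.rfl, Iff.rfl⟩)
    rw [Theory.models_sentence_iff, not_forall] at h1
    obtain ⟨N, hN⟩ := h1
    rw [sentence_realize_alls, not_forall] at hN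
    obtain ⟨b, hb⟩ := hN
    rw [realize_not, not_not, realize_diagramFormula] at hb
    refine ⟨N, fun u => if hu : u ∈ A then b (e ⟨u, hu⟩) else Classical.arbitrary N, ?_⟩
    intro u hu v hv
    simpa [hu, hv, a] using hb (e ⟨u, hu⟩) (e ⟨v, hv⟩)
  choose N g hg using hfin
  let u : Ultrafilter (Finset U) := Ultrafilter.of atTop
  have hu : ∀ a b : U, ∀ᶠ A in (u : Filter (Finset U)), a ∈ A ∧ b ∈ A := fun a b =>
    Ultrafilter.of_le atTop ((eventually_ge_atTop {a, b}).mono fun A hA =>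
      ⟨hA (by simp), hA (by simp)⟩)
  let K := (u : Filter (Finset U)).Product fun A => (N A : Type)
  have hK : K ⊨ T := ⟨fun φ hφ => (Ultraproduct.sentence_realize φ).2
    (Eventually.of_forall fun A => (N A).is_model.realize_of_mem φ hφ)⟩
  let f : U → K := fun a => ((fun A => g A a : ∀ A, N A) : K)
  have hf : ∀ a b, (f a = f b ↔ a = b) ∧ (edge K (f a) (f b) ↔ edge U a b) := by
    intro a b
    constructor
    · have h1 : f a = f b ↔ ∀ᶠ A in (u : Filter (Finset U)), g A a = g A b := Quotient.eq''
      rw [h1, eventually_congr ((hu a b).mono fun A hA => (hg A a hA.1 b hA.2).1),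
        eventually_const]
    · have h1 := Ultraproduct.boundedFormula_realize_cast (u := u) (M := fun A => (N A : Type))
        (adj.boundedFormula₂ (&0) (&1) : Language.graph.BoundedFormula Empty 2)
        (fun e => e.elim) ![fun A => g A a, fun A => g A b]
      simp only [realize_rel₂] at h1
      have h2 : edge K (f a) (f b) ↔
          ∀ᶠ A in (u : Filter (Finset U)), edge (N A) (g A a) (g A b) := h1
      rw [h2, eventually_congr ((hu a b).mono fun A hA => (hg A a hA.1 b hA.2).2),
        eventually_const]
  exact ⟨⟨K⟩, ⟨embeddingOfEdge ⟨⟨f, fun a b => (hf a b).1.1⟩, fun {a b} => (hf a b).2⟩⟩⟩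

/-- The countable form of the downward Löwenheim–Skolem theorem, with finite structures allowed. -/
theorem exists_countable_elementarySubstructure (M : Type) [Language.graph.Structure M] :
    ∃ S : Language.graph.ElementarySubstructure M, Countable S := by
  rcases finite_or_infinite M with hM | hM
  · exact ⟨⊤, inferInstance⟩
  · obtain ⟨S, -, hS⟩ := exists_elementarySubstructure_card_eq Language.graph (M := M) ∅
      Cardinal.aleph0.{0} le_rfl (by simp) (by simpa [Language.card] using Cardinal.mk_le_aleph0 (α := Language.graph.Symbols)) (by simp)
    exact ⟨S, Cardinal.mk_le_aleph0_iff.1 (by simpa using hS.le)⟩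

/-- The first-order theory of a generic digraph is a model companion of `ppTheory T_l`. -/
theorem IsGeneric.isModelCompanion {U : Type} [Language.graph.Structure U] [Nonempty U]
    {h : U → Fin l} (hg : IsGeneric (edge U) h) :
    IsModelCompanion (ppTheory (transitiveTournament l)) (Language.graph.completeTheory U) := by
  refine ⟨fun φ hφ => ⟨fun H => ?_, fun H => ?_⟩, fun M N f n φ x => ?_⟩
  · rw [Theory.models_sentence_iff] at H ⊢
    intro M
    obtain ⟨h', hg'⟩ := hg.of_model_completeTheory M
    have := model_ppTheory_iff.2 ⟨h', (hg' 0).isColoring⟩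
    exact H ⟨M⟩
  · have hU : U ⊨ φ := H.realize_sentence U
    rw [Theory.models_sentence_iff]
    intro M
    obtain ⟨S, hS⟩ := exists_countable_elementarySubstructure M
    obtain ⟨c, hc⟩ := model_ppTheory_iff.1 M.is_model
    rw [← S.realize_sentence]
    have hcS : IsColoring (edge S) fun x => c x := fun a b hab =>
      hc _ _ ((edge_map_iff S.subtype.toEmbedding a b).2 hab)
    obtain ⟨i⟩ := IsGeneric.nonempty_embedding hcS hg
    refine hφ.realize_embedding (embeddingOfEdge i) (v := default) (xs := default) ?_
    rwa [Subsingleton.elim (_ ∘ (default : Empty → S)) default,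
      Subsingleton.elim (_ ∘ (default : Fin 0 → S)) default]
  · obtain ⟨hM, hgM⟩ := hg.of_model_completeTheory M
    obtain ⟨hN, hgN⟩ := hg.of_model_completeTheory N
    obtain ⟨R, hR⟩ := exists_genericity_bound l φ
    -- The colouring of `N` restricts to the unique colouring of `M`, so `x` and `f ∘ x` match.
    have hcol : (fun a => hN (f a)) = hM := ((hgM 1).ext 1 le_rfl).coloring_unique fun a b hab =>
      (hgN 0).isColoring _ _ ((edge_map_iff f a b).2 hab)
    refine (hR M N hM hN (hgM R) (hgN R) x default (f ∘ x) default ⟨?_, ?_, ?_⟩).symm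
    · rintro (i | i)
      · exact (congrFun hcol (x i)).symm
      · exact i.elim0
    · rintro (i | i) (j | j)
      · exact f.injective.eq_iff.symm
      all_goals first | exact i.elim0 | exact j.elim0
    · rintro (i | i) (j | j)
      · exact (edge_map_iff f _ _).symm
      all_goals first | exact i.elim0 | exact j.elim0

/-- Every countable model of a model companion of `ppTheory T_l` is generic: it embeds into the
countable generic digraph, which embeds into a model of the companion, and the composition is
elementary. -/
theorem IsModelCompanion.exists_isGeneric {T : Language.graph.Theory}
    (hT : IsModelCompanion (ppTheory (transitiveTournament l)) T) (hl : 1 ≤ l) (N : Type)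
    [Language.graph.Structure N] [Nonempty N] [Countable N] [N ⊨ T] :
    ∃ h : N → Fin l, IsGeneric (edge N) h := by
  have hcol : ∀ K : Theory.ModelType.{0, 0, 0} T, ∃ h : K → Fin l, IsColoring (edge K) h := by
    refine fun K => realize_noWalkSentence.1 (Theory.models_sentence_iff.1
      ((hT.1 _ (isUniversal_noWalkSentence l)).1 (Theory.models_sentence_iff.2 fun M => ?_)) K)
    exact realize_noWalkSentence.2 (model_ppTheory_iff.1 M.is_model)
  obtain ⟨c, hc⟩ := hcol ⟨N⟩
  obtain ⟨E, h, hg⟩ := exists_isGeneric_nat hl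
  let := toStructure (⟨E⟩ : Digraph ℕ)
  have hgU : IsGeneric (edge ℕ) h := hg
  obtain ⟨i⟩ := IsGeneric.nonempty_embedding hc hgU
  have hUmod : ℕ ⊨ ppTheory (transitiveTournament l) :=
    model_ppTheory_iff.2 ⟨h, (hgU 0).isColoring⟩
  obtain ⟨K, ⟨j⟩⟩ := exists_embedding_of_universal (T := T) (U := ℕ) fun φ hφ hTφ =>
    ((hT.1 φ hφ).2 hTφ).realize_sentence ℕ
  obtain ⟨d, hd⟩ := hcol K
  let f : N ↪ₑ[Language.graph] K :=
    ⟨j.comp (embeddingOfEdge i), fun n φ x => hT.2 ⟨N⟩ K (j.comp (embeddingOfEdge i)) n φ x⟩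
  exact ⟨_, hgU.of_elementary i ⟨⟨j, j.injective⟩, fun {a b} => edge_map_iff j a b⟩ f
    (fun _ => rfl) hd⟩

theorem IsModelCompanion.isSatisfiable {T : Language.graph.Theory}
    (hT : IsModelCompanion (ppTheory (transitiveTournament l)) T) (hl : 1 ≤ l) :
    T.IsSatisfiable := by
  obtain ⟨E, h, hg⟩ := exists_isGeneric_nat hl
  let := toStructure (⟨E⟩ : Digraph ℕ)
  have hgU : IsGeneric (edge ℕ) h := hg
  have hUmod : ℕ ⊨ ppTheory (transitiveTournament l) :=
    model_ppTheory_iff.2 ⟨h, (hgU 0).isColoring⟩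
  obtain ⟨K, -⟩ := exists_embedding_of_universal (T := T) (U := ℕ) fun φ hφ hTφ =>
    ((hT.1 φ hφ).2 hTφ).realize_sentence ℕ
  exact ⟨K⟩

theorem IsModelCompanion.isOmegaCategorical {T : Language.graph.Theory}
    (hT : IsModelCompanion (ppTheory (transitiveTournament l)) T) (hl : 1 ≤ l) :
    IsOmegaCategorical T := by
  refine ⟨hT.isSatisfiable hl, fun M N hM hN => ?_⟩
  obtain ⟨h, hg⟩ := hT.exists_isGeneric hl M
  obtain ⟨h', hg'⟩ := hT.exists_isGeneric hl N
  obtain ⟨e⟩ := hg.nonempty_relIso hg'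
  exact ⟨equivOfEdge e⟩

theorem IsModelCompanion.exists_countable_model {T : Language.graph.Theory}
    (hT : IsModelCompanion (ppTheory (transitiveTournament l)) T) (hl : 1 ≤ l) :
    ∃ (V : Type) (U : Digraph V), Nonempty V ∧ Countable V ∧ T ⊆ theoryOf U := by
  obtain ⟨K⟩ := hT.isSatisfiable hl
  obtain ⟨S, hS⟩ := exists_countable_elementarySubstructure K
  refine ⟨S, ⟨edge S⟩, inferInstance, hS, fun φ hφ => ?_⟩
  have hstr : toStructure (⟨edge S⟩ : Digraph S) = (inferInstance : Language.graph.Structure S) := by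
    ext n r x
    · exact isEmptyElim r
    · cases r
      exact (relMap_adj_iff x).symm
  have hSφ : S ⊨ φ := (S.realize_sentence φ).2 (K.is_model.realize_of_mem φ hφ)
  change Satisfies _ φ
  unfold Satisfies
  rw [hstr]
  exact hSφ

end Companions


/-! ### Counting digraphs with a given colouring -/

section Counting

/-- The number of subsets of `Ω` that differ from `T` on every one of the pairwise disjoint blocks
`B x`, each of size at most `m`. -/
theorem card_filter_ne_on_blocks {α ι : Type} [DecidableEq α] [DecidableEq ι] (Ω T : Finset α)
    (B : ι → Finset α) (m : ℕ) (X : Finset ι)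
    (hB : ∀ x ∈ X, ∀ y ∈ X, x ≠ y → Disjoint (B x) (B y)) (hΩ : ∀ x ∈ X, B x ⊆ Ω)
    (hm : ∀ x ∈ X, (B x).card ≤ m) :
    ((Ω.powerset.filter fun S => ∀ x ∈ X, S ∩ B x ≠ T ∩ B x).card : ℝ) ≤
      (1 - (1 / 2) ^ m) ^ X.card * 2 ^ Ω.card := by
  induction X using Finset.induction_on with
  | empty => simp
  | insert x X hx ih =>
    have ih' := ih (fun y hy z hz => hB y (Finset.mem_insert_of_mem hy) z
      (Finset.mem_insert_of_mem hz)) (fun y hy => hΩ y (Finset.mem_insert_of_mem hy))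
      (fun y hy => hm y (Finset.mem_insert_of_mem hy))
    set F := Ω.powerset.filter fun S => ∀ y ∈ X, S ∩ B y ≠ T ∩ B y with hF
    have hsplit : (F.filter fun S => S ∩ B x = T ∩ B x).card +
        (F.filter fun S => S ∩ B x ≠ T ∩ B x).card = F.card :=
      Finset.card_filter_add_card_filter_not _
    have hins : (Ω.powerset.filter fun S => ∀ y ∈ insert x X, S ∩ B y ≠ T ∩ B y) =
        F.filter fun S => S ∩ B x ≠ T ∩ B x := by
      ext S
      simp only [hF, Finset.mem_filter, Finset.forall_mem_insert]
      tauto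
    -- Replacing `S` on the block `B x` by `T` is a map with fibres of size at most `2 ^ m`.
    have hle : F.card ≤ 2 ^ m * (F.filter fun S => S ∩ B x = T ∩ B x).card := by
      refine Finset.card_le_mul_card_image_of_maps_to
        (f := fun S => (S \ B x) ∪ (T ∩ B x)) (fun S hS => ?_) _ fun b _ => ?_
      · simp only [hF, Finset.mem_filter, Finset.mem_powerset] at hS ⊢
        refine ⟨⟨Finset.union_subset (Finset.sdiff_subset.trans hS.1)
          (Finset.inter_subset_right.trans (hΩ x (Finset.mem_insert_self _ _))),
          fun y hy => ?_⟩, ?_⟩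
        · have hdis := Finset.disjoint_left.1 (hB y (Finset.mem_insert_of_mem hy) x
            (Finset.mem_insert_self _ _) fun h => hx (h ▸ hy))
          have hSy : ((S \ B x) ∪ (T ∩ B x)) ∩ B y = S ∩ B y := by
            clear * - hdis
            grind
          rw [hSy]
          exact hS.2 y hy
        · clear * -
          grind
      · calc _ ≤ (B x).powerset.card := by
              refine Finset.card_le_card_of_injOn (fun S => S ∩ B x)
                (fun S _ => Finset.mem_coe.2 (Finset.mem_powerset.2 Finset.inter_subset_right)) ?_
              intro S hS S' hS' h
              simp only [Finset.coe_filter, Set.mem_ofPred_eq] at hS hS'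
              have h2 := hS.2.trans hS'.2.symm
              ext a
              have h3 := Finset.ext_iff.1 h a
              have h4 := Finset.ext_iff.1 h2 a
              by_cases hab : a ∈ B x
              · simpa [hab] using h3
              · simpa [hab] using h4
          _ ≤ 2 ^ m := by
              rw [Finset.card_powerset]
              exact Nat.pow_le_pow_right two_pos (hm x (Finset.mem_insert_self _ _))
    rw [hins, Finset.card_insert_of_notMem hx, pow_succ]
    have h1 : (0 : ℝ) ≤ 1 - (1 / 2) ^ m :=
      sub_nonneg.2 (pow_le_one₀ (by norm_num) (by norm_num))
    have h2 : ((F.filter fun S => S ∩ B x ≠ T ∩ B x).card : ℝ) =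
        F.card - (F.filter fun S => S ∩ B x = T ∩ B x).card := by
      rw [← hsplit]; push_cast; ring
    have h3 : (F.card : ℝ) * (1 / 2) ^ m ≤ (F.filter fun S => S ∩ B x = T ∩ B x).card := by
      have : (F.card : ℝ) ≤ 2 ^ m * (F.filter fun S => S ∩ B x = T ∩ B x).card := by
        exact_mod_cast hle
      rw [one_div, inv_pow, ← div_eq_mul_inv, div_le_iff₀ (by positivity)]
      linarith
    calc _ ≤ (1 - (1 / 2) ^ m) * (F.card : ℝ) := by rw [h2]; linarith
      _ ≤ (1 - (1 / 2) ^ m) * ((1 - (1 / 2) ^ m) ^ X.card * 2 ^ Ω.card) :=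
          mul_le_mul_of_nonneg_left ih' h1
      _ = _ := by ring

variable {V : Type} [Fintype V] {l : ℕ}

/-- The pairs that may be edges of a digraph with the colouring `h`. -/
def admissible (h : V → Fin l) : Finset (V × V) :=
  Finset.univ.filter fun p => h p.1 < h p.2

/-- The relation with a given set of pairs. -/
def relOf (S : Finset (V × V)) (u v : V) : Prop :=
  (u, v) ∈ S

theorem isColoring_relOf_iff {S : Finset (V × V)} {h : V → Fin l} :
    IsColoring (relOf S) h ↔ S ⊆ admissible h := by
  constructor
  · rintro hc ⟨u, v⟩ huv
    exact Finset.mem_filter.2 ⟨Finset.mem_univ _, hc u v huv⟩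
  · exact fun hS u v huv => (Finset.mem_filter.1 (hS huv)).2

open Classical in
/-- The number of digraphs with the colouring `h` in which one given instance of the extension
property fails. -/
theorem card_filter_no_extension (h : V → Fin l) (R : ℕ) (F Q : Finset V) (hF : F.card ≤ R)
    (k : Fin l) :
    (((admissible h).powerset.filter fun S => ¬ ∃ x, x ∉ F ∧ h x = k ∧ ∀ y ∈ F,
      (h y < k → (relOf S y x ↔ y ∈ Q)) ∧ (k < h y → (relOf S x y ↔ y ∈ Q))).card : ℝ) ≤
      (1 - (1 / 2) ^ R) ^ ((Finset.univ.filter fun x => h x = k).card - R) *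
        2 ^ (admissible h).card := by
  -- Whether `x ∈ X` is a witness depends only on the block `B x` of pairs that join `x` to `F`.
  -- These blocks are disjoint, and `x` is a witness if the edge set agrees with `T` on `B x`.
  let X : Finset V := (Finset.univ.filter fun x => h x = k) \ F
  let B : V → Finset (V × V) := fun x =>
    (F.filter fun y => h y ≠ k).image fun y => if h y < k then (y, x) else (x, y)
  let T : Finset (V × V) := Finset.univ.filter fun p =>
    (p.1 ∈ F ∧ p.1 ∈ Q) ∨ (p.2 ∈ F ∧ p.2 ∈ Q)
  have hX : ∀ x ∈ X, h x = k ∧ x ∉ F := fun x hx => by simpa [X] using hx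
  have hBmem : ∀ x p, p ∈ B x ↔ ∃ y ∈ F, h y ≠ k ∧ (if h y < k then (y, x) else (x, y)) = p :=
    fun x p => by simp [B, and_assoc]
  have hc0 : (0 : ℝ) ≤ 1 - (1 / 2) ^ R :=
    sub_nonneg.2 (pow_le_one₀ (by norm_num) (by norm_num))
  have hc1 : (1 : ℝ) - (1 / 2) ^ R ≤ 1 := sub_le_self _ (by positivity)
  have key := card_filter_ne_on_blocks (admissible h) T B R X ?_ ?_ ?_
  · refine le_trans ?_ (key.trans ?_)
    · refine Nat.cast_le.2 (Finset.card_le_card fun S hS => ?_)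
      simp only [Finset.mem_filter] at hS ⊢
      refine ⟨hS.1, fun x hx hST => hS.2 ⟨x, (hX x hx).2, (hX x hx).1, fun y hy => ?_⟩⟩
      have hmem : ∀ p ∈ B x, p ∈ S ↔ p ∈ T := fun p hp => by
        have := Finset.ext_iff.1 hST p
        simpa [hp] using this
      constructor
      · intro hlt
        refine (hmem (y, x) ((hBmem _ _).2 ⟨y, hy, hlt.ne, if_pos hlt⟩)).trans ?_
        simp [T, hy, (hX x hx).2]
      · intro hlt
        refine (hmem (x, y) ((hBmem _ _).2 ⟨y, hy, hlt.ne', if_neg hlt.not_gt⟩)).trans ?_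
        simp [T, hy, (hX x hx).2]
    · refine mul_le_mul_of_nonneg_right (pow_le_pow_of_le_one hc0 hc1 ?_) (by positivity)
      have := Finset.le_card_sdiff F (Finset.univ.filter fun x => h x = k)
      exact (Nat.sub_le_sub_left hF _).trans this
  · intro x hx x' hx' hne
    rw [Finset.disjoint_left]
    intro p hp hp'
    obtain ⟨y, hy, -, rfl⟩ := (hBmem x p).1 hp
    obtain ⟨y', hy', -, hyy⟩ := (hBmem x' _).1 hp'
    have h1 := (hX x hx).2
    have h2 := (hX x' hx').2
    split_ifs at hyy <;> simp only [Prod.mk.injEq] at hyy <;> aesop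
  · intro x hx p hp
    obtain ⟨y, hy, hyk, rfl⟩ := (hBmem x p).1 hp
    have hxk := (hX x hx).1
    refine Finset.mem_filter.2 ⟨Finset.mem_univ _, ?_⟩
    split_ifs with hlt
    · simpa [hxk] using hlt
    · simpa [hxk] using lt_of_le_of_ne (not_lt.1 hlt) hyk.symm
  · exact fun x _ => Finset.card_image_le.trans ((Finset.card_filter_le _ _).trans hF)

open Classical in
/-- The number of digraphs with the colouring `h` that are not sufficiently generic, by the union
bound. -/
theorem card_filter_not_generic (h : V → Fin l) (R q : ℕ)
    (hq : ∀ k, q ≤ (Finset.univ.filter fun x => h x = k).card) :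
    (((admissible h).powerset.filter fun S => ¬ IsGenericUpTo (relOf S) h R).card : ℝ) ≤
      (R + 1) * (Fintype.card V + 1) ^ R * 2 ^ R * l * (1 - (1 / 2) ^ R) ^ (q - R) *
        2 ^ (admissible h).card := by
  let 𝓕 : Finset (Finset V) := (Finset.range (R + 1)).biUnion fun m =>
    Finset.univ.powersetCard m
  let J : Finset ((F : Finset V) × (Finset V × Fin l)) :=
    𝓕.sigma fun F => F.powerset ×ˢ Finset.univ
  let bad : ((F : Finset V) × (Finset V × Fin l)) → Finset (Finset (V × V)) := fun j =>
    (admissible h).powerset.filter fun S => ¬ ∃ x, x ∉ j.1 ∧ h x = j.2.2 ∧ ∀ y ∈ j.1,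
      (h y < j.2.2 → (relOf S y x ↔ y ∈ j.2.1)) ∧ (j.2.2 < h y → (relOf S x y ↔ y ∈ j.2.1))
  have h𝓕 : ∀ F, F ∈ 𝓕 ↔ F.card ≤ R := fun F => by
    simp [𝓕, Finset.mem_powersetCard]
  have hc0 : (0 : ℝ) ≤ 1 - (1 / 2) ^ R :=
    sub_nonneg.2 (pow_le_one₀ (by norm_num) (by norm_num))
  have hc1 : (1 : ℝ) - (1 / 2) ^ R ≤ 1 := sub_le_self _ (by positivity)
  have hsub : ((admissible h).powerset.filter fun S => ¬ IsGenericUpTo (relOf S) h R) ⊆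
      J.biUnion bad := by
    intro S hS
    rw [Finset.mem_filter, Finset.mem_powerset] at hS
    obtain ⟨hSA, hS⟩ := hS
    by_contra hcon
    refine hS ⟨isColoring_relOf_iff.2 hSA, fun m hm F hF P k => ?_⟩
    by_contra hx
    refine hcon (Finset.mem_biUnion.2 ⟨⟨F, F.filter P, k⟩, ?_, ?_⟩)
    · simp [J, h𝓕, hF, hm]
    · refine Finset.mem_filter.2 ⟨Finset.mem_powerset.2 hSA, fun ⟨x, hxF, hxk, H⟩ => hx ?_⟩
      refine ⟨x, hxF, hxk, fun y hy => ?_⟩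
      simpa [hy] using H y hy
  have hJ : (J.card : ℝ) ≤ (R + 1) * (Fintype.card V + 1) ^ R * 2 ^ R * l := by
    have h1 : 𝓕.card ≤ (R + 1) * (Fintype.card V + 1) ^ R := by
      refine Finset.card_biUnion_le.trans ((Finset.sum_le_card_nsmul _ _
        ((Fintype.card V + 1) ^ R) fun m hm => ?_).trans (by simp))
      rw [Finset.card_powersetCard, Finset.card_univ]
      calc _ ≤ Fintype.card V ^ m := Nat.choose_le_pow _ _
        _ ≤ (Fintype.card V + 1) ^ m := Nat.pow_le_pow_left (Nat.le_succ _) _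
        _ ≤ _ := Nat.pow_le_pow_right (Nat.succ_pos _) (Nat.lt_succ_iff.1 (Finset.mem_range.1 hm))
    have h2 : J.card ≤ 𝓕.card * (2 ^ R * l) := by
      rw [Finset.card_sigma]
      refine Finset.sum_le_card_nsmul _ _ _ fun F hF => ?_
      rw [Finset.card_product, Finset.card_powerset, Finset.card_univ, Fintype.card_fin]
      exact Nat.mul_le_mul_right _ (Nat.pow_le_pow_right two_pos ((h𝓕 F).1 hF))
    have h3 : J.card ≤ (R + 1) * (Fintype.card V + 1) ^ R * 2 ^ R * l :=
      h2.trans ((Nat.mul_le_mul_right _ h1).trans (by rw [mul_assoc _ (2 ^ R)]))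
    exact_mod_cast h3
  calc _ ≤ ((J.biUnion bad).card : ℝ) := Nat.cast_le.2 (Finset.card_le_card hsub)
    _ ≤ ∑ j ∈ J, ((bad j).card : ℝ) := by exact_mod_cast Finset.card_biUnion_le
    _ ≤ ∑ j ∈ J, ((1 - (1 / 2) ^ R) ^ (q - R) * 2 ^ (admissible h).card : ℝ) := by
        refine Finset.sum_le_sum fun j hj => ?_
        have hj1 : j.1.card ≤ R := (h𝓕 _).1 (Finset.mem_sigma.1 hj).1
        refine (card_filter_no_extension h R j.1 j.2.1 hj1 j.2.2).trans ?_
        exact mul_le_mul_of_nonneg_right (pow_le_pow_of_le_one hc0 hc1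
          (Nat.sub_le_sub_right (hq _) _)) (by positivity)
    _ = J.card * ((1 - (1 / 2) ^ R) ^ (q - R) * 2 ^ (admissible h).card) := by
        rw [Finset.sum_const, nsmul_eq_mul]
    _ ≤ _ := by
        rw [mul_assoc _ ((1 - (1 / 2 : ℝ) ^ R) ^ (q - R))]
        exact mul_le_mul_of_nonneg_right hJ (by positivity)

/-! ### Unbalanced colourings -/

/-- The number of admissible pairs of a colouring is determined by the sizes of its classes. -/
theorem two_mul_card_admissible (h : V → Fin l) :
    2 * (admissible h).card + ∑ k, (Finset.univ.filter fun x => h x = k).card ^ 2 =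
      Fintype.card V ^ 2 := by
  have h1 : (Finset.univ.filter fun p : V × V => h p.2 < h p.1).card = (admissible h).card := by
    refine Finset.card_bij (fun p _ => p.swap) ?_ ?_ ?_
    · intro p hp
      simpa [admissible] using hp
    · intro p _ q _ hpq
      exact Prod.swap_injective hpq
    · intro p hp
      exact ⟨p.swap, by simpa [admissible] using hp, Prod.swap_swap p⟩
  have h2 : (Finset.univ.filter fun p : V × V => h p.1 = h p.2).card =
      ∑ k, (Finset.univ.filter fun x => h x = k).card ^ 2 := by
    rw [Finset.card_eq_sum_card_fiberwise (t := Finset.univ) (f := fun p : V × V => h p.1)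
      fun _ _ => Finset.mem_coe.2 (Finset.mem_univ _)]
    refine Finset.sum_congr rfl fun k _ => ?_
    rw [sq, ← Finset.card_product]
    congr 1
    ext p
    simp only [Finset.mem_filter, Finset.mem_univ, true_and, Finset.mem_product]
    constructor
    · rintro ⟨h3, h4⟩
      exact ⟨h4, h3 ▸ h4⟩
    · rintro ⟨h3, h4⟩
      exact ⟨h3.trans h4.symm, h3⟩
  rw [← h2, sq, ← Fintype.card_prod, ← Finset.card_univ (α := V × V),
    ← Finset.card_filter_add_card_filter_not (s := Finset.univ)
      (fun p : V × V => h p.1 = h p.2),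
    ← Finset.card_filter_add_card_filter_not
      (s := Finset.univ.filter fun p : V × V => ¬ h p.1 = h p.2) (fun p : V × V => h p.1 < h p.2),
    Finset.filter_filter, Finset.filter_filter]
  have h3 : (Finset.univ.filter fun p : V × V => ¬ h p.1 = h p.2 ∧ h p.1 < h p.2) =
      admissible h := by
    ext p
    simpa [admissible] using fun h : _ < _ => h.ne
  have h4 : (Finset.univ.filter fun p : V × V => ¬ h p.1 = h p.2 ∧ ¬ h p.1 < h p.2) =
      Finset.univ.filter fun p : V × V => h p.2 < h p.1 := by
    ext p
    simp only [Finset.mem_filter, Finset.mem_univ, true_and]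
    exact ⟨fun ⟨h5, h6⟩ => lt_of_le_of_ne (not_lt.1 h6) (Ne.symm h5),
      fun h5 => ⟨h5.ne', h5.not_gt⟩⟩
  rw [h3, h4, h1]
  ring

theorem sum_card_classes (h : V → Fin l) :
    ∑ k, (Finset.univ.filter fun x => h x = k).card = Fintype.card V := by
  rw [← Finset.card_univ, Finset.card_eq_sum_card_fiberwise (t := Finset.univ) (f := h)
    fun _ _ => Finset.mem_coe.2 (Finset.mem_univ _)]

theorem sum_sq_deviation (hl : 1 ≤ l) (h : V → Fin l) :
    ∑ k, (((Finset.univ.filter fun x => h x = k).card : ℝ) - Fintype.card V / l) ^ 2 =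
      Fintype.card V ^ 2 - 2 * (admissible h).card - (Fintype.card V : ℝ) ^ 2 / l := by
  have hl0 : (l : ℝ) ≠ 0 := Nat.cast_ne_zero.2 (by omega)
  have h1 : ∑ k, ((Finset.univ.filter fun x => h x = k).card : ℝ) = Fintype.card V := by
    exact_mod_cast sum_card_classes h
  have h2 : 2 * ((admissible h).card : ℝ) +
      ∑ k, ((Finset.univ.filter fun x => h x = k).card : ℝ) ^ 2 = Fintype.card V ^ 2 := by
    exact_mod_cast two_mul_card_admissible h
  simp only [sub_sq, Finset.sum_add_distrib, Finset.sum_sub_distrib, ← Finset.sum_mul,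
    ← Finset.mul_sum, h1, Finset.sum_const, Finset.card_univ, Fintype.card_fin, nsmul_eq_mul]
  rw [eq_sub_of_add_eq' h2]
  field_simp
  ring

/-- The colouring of `Fin n` by residues modulo `l`. -/
def residueColoring (n : ℕ) (hl : 1 ≤ l) (v : Fin n) : Fin l :=
  ⟨v % l, Nat.mod_lt _ hl⟩

theorem card_residue_class (n : ℕ) (hl : 1 ≤ l) (k : Fin l) :
    |((Finset.univ.filter fun x => residueColoring n hl x = k).card : ℝ) - n / l| ≤ 1 := by
  have h1 : (Finset.univ.filter fun x => residueColoring n hl x = k).card =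
      n / l + if (k : ℕ) % l < n % l then 1 else 0 := by
    rw [← Nat.count_modEq_card n hl k, Nat.count_eq_card_filter_range, Finset.card_filter,
      Finset.card_filter, ← Fin.sum_univ_eq_sum_range (fun i => if i ≡ k [MOD l] then 1 else 0) n]
    refine Finset.sum_congr rfl fun i _ => ?_
    congr 1
    rw [residueColoring, Fin.ext_iff, Nat.ModEq, Nat.mod_eq_of_lt k.isLt]
  have hl0 : (0 : ℝ) < l := Nat.cast_pos.2 hl
  have h2 : (n : ℝ) / l = (n / l : ℕ) + (n % l : ℕ) / l := by
    have : (n : ℝ) = l * (n / l : ℕ) + (n % l : ℕ) := by exact_mod_cast (Nat.div_add_mod n l).symm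
    field_simp
    linarith
  have h3 : ((n % l : ℕ) : ℝ) / l ≤ 1 :=
    (div_le_one hl0).2 (by exact_mod_cast (Nat.mod_lt n hl).le)
  have h4 : (0 : ℝ) ≤ ((n % l : ℕ) : ℝ) / l := by positivity
  rw [h1, h2, abs_le]
  split_ifs <;> push_cast <;> constructor <;> linarith

/-- A colouring with a small class admits far fewer digraphs than the colouring by residues. -/
theorem card_admissible_add_le {n : ℕ} (hl : 1 ≤ l) (hn : 4 * l ^ 2 * (2 * l + 3) ≤ n)
    (h : Fin n → Fin l) (k : Fin l)
    (hk : 2 * l * (Finset.univ.filter fun x => h x = k).card < n) :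
    (admissible h).card + (l + 1) * n ≤ (admissible (residueColoring n hl)).card := by
  have hl1 : (1 : ℝ) ≤ l := by exact_mod_cast hl
  have hl0 : (0 : ℝ) < l := by linarith
  have h1 := sum_sq_deviation hl h
  have h2 := sum_sq_deviation hl (residueColoring n hl)
  rw [Fintype.card_fin] at h1 h2
  -- The number of admissible pairs decreases with the squared deviation of the class sizes from
  -- `n / l`, which is at most `l` for the residues and at least `(n / (2 l)) ^ 2` for `h`.
  have h3 : ∑ k, (((Finset.univ.filter fun x => residueColoring n hl x = k).card : ℝ) - n / l) ^ 2
      ≤ l := by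
    refine (Finset.sum_le_card_nsmul _ _ 1 fun k _ => ?_).trans (by simp)
    exact (sq_le_one_iff_abs_le_one _).2 (card_residue_class n hl k)
  have h4 : ((n : ℝ) / (2 * l)) ^ 2 ≤
      ∑ k, (((Finset.univ.filter fun x => h x = k).card : ℝ) - n / l) ^ 2 := by
    refine le_trans ?_ (Finset.single_le_sum (f := fun k =>
      (((Finset.univ.filter fun x => h x = k).card : ℝ) - n / l) ^ 2)
      (fun _ _ => sq_nonneg _) (Finset.mem_univ k))
    have hk' : 2 * (l : ℝ) * (Finset.univ.filter fun x => h x = k).card ≤ n := by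
      exact_mod_cast hk.le
    have h5 : ((Finset.univ.filter fun x => h x = k).card : ℝ) ≤ n / (2 * l) := by
      rw [le_div_iff₀ (by positivity)]
      linarith
    have h6 : (n : ℝ) / l = 2 * (n / (2 * l)) := by field_simp
    have h7 : (0 : ℝ) ≤ n / (2 * l) := by positivity
    rw [h6]
    nlinarith
  have hn' : 4 * (l : ℝ) ^ 2 * (2 * l + 3) ≤ n := by exact_mod_cast hn
  have h5 : (2 * (l : ℝ) + 3) * n ≤ (n / (2 * l)) ^ 2 := by
    rw [div_pow, le_div_iff₀ (by positivity)]
    nlinarith [mul_le_mul_of_nonneg_right hn' (Nat.cast_nonneg (α := ℝ) n)]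
  have h6 : (l : ℝ) ≤ n := by nlinarith
  have h7 : ((admissible h).card : ℝ) + (l + 1) * n ≤
      (admissible (residueColoring n hl)).card := by nlinarith
  exact_mod_cast h7

end Counting


/-! ### Almost all colourable digraphs are sufficiently generic -/

section Asymptotics

open Classical in
/-- The edge sets of the digraphs on `Fin n` with a homomorphism to `T_l`. -/
noncomputable def colorable (l n : ℕ) : Finset (Finset (Fin n × Fin n)) :=
  Finset.univ.filter fun S => ∃ h : Fin n → Fin l, IsColoring (relOf S) h

open Classical in
/-- The edge sets of the digraphs on `Fin n` that are generic over sets of at most `R` vertices. -/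
noncomputable def genericSets (l R n : ℕ) : Finset (Finset (Fin n × Fin n)) :=
  Finset.univ.filter fun S => ∃ h : Fin n → Fin l, IsGenericUpTo (relOf S) h R

theorem mem_colorable {l n : ℕ} {S : Finset (Fin n × Fin n)} :
    S ∈ colorable l n ↔ ∃ h : Fin n → Fin l, IsColoring (relOf S) h := by
  simp [colorable]

theorem mem_genericSets {l R n : ℕ} {S : Finset (Fin n × Fin n)} :
    S ∈ genericSets l R n ↔ ∃ h : Fin n → Fin l, IsGenericUpTo (relOf S) h R := by
  simp [genericSets]

open Classical in
/-- The number of colourable digraphs that are not generic, given a bound `ε` for the proportion of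
digraphs that are not generic with respect to a fixed balanced colouring. Generic digraphs have only
one colouring, so the sets of digraphs that are generic with respect to different colourings are
disjoint. -/
theorem card_colorable_not_generic {l R n : ℕ} (hl : 1 ≤ l) (hR : 1 ≤ R)
    (hn : 4 * l ^ 2 * (2 * l + 3) ≤ n) {ε : ℝ} (hε0 : 0 ≤ ε) (hε1 : ε ≤ 1 / 2)
    (hε : ∀ h : Fin n → Fin l,
      (∀ k, n ≤ 2 * l * (Finset.univ.filter fun x => h x = k).card) →
      (((admissible h).powerset.filter fun S => ¬ IsGenericUpTo (relOf S) h R).card : ℝ) ≤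
        ε * 2 ^ (admissible h).card) :
    (((colorable l n).filter fun S => S ∉ genericSets l R n).card : ℝ) ≤
      (2 * ε + (1 / 2) ^ n) * (colorable l n).card := by
  let bad : (Fin n → Fin l) → Finset (Finset (Fin n × Fin n)) := fun h =>
    (admissible h).powerset.filter fun S => ¬ IsGenericUpTo (relOf S) h R
  let good : (Fin n → Fin l) → Finset (Finset (Fin n × Fin n)) := fun h =>
    (admissible h).powerset.filter fun S => IsGenericUpTo (relOf S) h R
  let bal : Finset (Fin n → Fin l) := Finset.univ.filter fun h =>
    ∀ k, n ≤ 2 * l * (Finset.univ.filter fun x => h x = k).card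
  set C : ℝ := ((colorable l n).card : ℝ) with hC
  have hcol : ∀ h : Fin n → Fin l, (admissible h).powerset ⊆ colorable l n := fun h S hS =>
    mem_colorable.2 ⟨h, isColoring_relOf_iff.2 (Finset.mem_powerset.1 hS)⟩
  have hsplit : ∀ h, ((good h).card : ℝ) + (bad h).card = 2 ^ (admissible h).card := fun h => by
    have := Finset.card_filter_add_card_filter_not (s := (admissible h).powerset)
      (fun S => IsGenericUpTo (relOf S) h R)
    rw [Finset.card_powerset] at this
    exact_mod_cast this
  have hgood : ∑ h ∈ bal, ((good h).card : ℝ) ≤ C := by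
    have hdis : (bal : Set (Fin n → Fin l)).PairwiseDisjoint good := by
      intro h _ h' _ hne
      refine Finset.disjoint_left.2 fun S hS hS' => hne ?_
      exact ((Finset.mem_filter.1 hS').2.ext 1 hR).coloring_unique
        (Finset.mem_filter.1 hS).2.isColoring
    rw [hC, ← Nat.cast_sum, ← Finset.card_biUnion hdis]
    refine Nat.cast_le.2 (Finset.card_le_card (Finset.biUnion_subset.2 fun h _ => ?_))
    exact (Finset.filter_subset _ _).trans (hcol h)
  have hbal : ∑ h ∈ bal, ((bad h).card : ℝ) ≤ 2 * ε * C := by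
    refine le_trans (Finset.sum_le_sum (g := fun h => 2 * ε * ((good h).card : ℝ))
      fun h hh => ?_) ?_
    · have h1 : ((bad h).card : ℝ) ≤ ε * 2 ^ (admissible h).card :=
        hε h (Finset.mem_filter.1 hh).2
      have h2 : ((bad h).card : ℝ) ≤ 1 / 2 * 2 ^ (admissible h).card :=
        h1.trans (mul_le_mul_of_nonneg_right hε1 (by positivity))
      have h3 : (2 : ℝ) ^ (admissible h).card ≤ 2 * (good h).card := by linarith [hsplit h]
      calc _ ≤ ε * 2 ^ (admissible h).card := h1
        _ ≤ ε * (2 * (good h).card) := mul_le_mul_of_nonneg_left h3 hε0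
        _ = _ := by ring
    · rw [← Finset.mul_sum]
      exact mul_le_mul_of_nonneg_left hgood (by positivity)
  have hunbal : ∑ h ∈ Finset.univ.filter (fun h => h ∉ bal), ((bad h).card : ℝ) ≤
      (1 / 2) ^ n * C := by
    have h1 : ∀ h ∈ Finset.univ.filter (fun h => h ∉ bal),
        ((bad h).card : ℝ) ≤ (1 / 2) ^ ((l + 1) * n) * C := by
      intro h hh
      obtain ⟨k, hk⟩ : ∃ k, 2 * l * (Finset.univ.filter fun x => h x = k).card < n := by
        simpa [bal] using hh
      have h2 := card_admissible_add_le hl hn h k hk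
      have h3 : ((bad h).card : ℝ) ≤ 2 ^ (admissible h).card := by
        linarith [hsplit h, Nat.cast_nonneg (α := ℝ) (good h).card]
      have h4 : (2 : ℝ) ^ (admissible (residueColoring n hl)).card ≤ C := by
        have := Finset.card_le_card (hcol (residueColoring n hl))
        rw [Finset.card_powerset] at this
        rw [hC]
        exact_mod_cast this
      have h5 : (2 : ℝ) ^ (admissible h).card * 2 ^ ((l + 1) * n) ≤ C := by
        rw [← pow_add]
        exact (pow_le_pow_right₀ one_le_two h2).trans h4
      rw [one_div, inv_pow, inv_mul_eq_div, le_div_iff₀ (by positivity)]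
      exact (mul_le_mul_of_nonneg_right h3 (by positivity)).trans h5
    refine (Finset.sum_le_card_nsmul _ _ _ h1).trans ?_
    rw [nsmul_eq_mul, ← mul_assoc]
    refine mul_le_mul_of_nonneg_right ?_ (Nat.cast_nonneg _)
    have h2 : ((Finset.univ.filter (fun h : Fin n → Fin l => h ∉ bal)).card : ℝ) ≤
        2 ^ (l * n) := by
      have : (Finset.univ.filter (fun h : Fin n → Fin l => h ∉ bal)).card ≤ 2 ^ (l * n) := by
        refine (Finset.card_filter_le _ _).trans ?_
        rw [Finset.card_univ, Fintype.card_fun, Fintype.card_fin, Fintype.card_fin, pow_mul]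
        exact Nat.pow_le_pow_left Nat.lt_two_pow_self.le n
      exact_mod_cast this
    calc _ ≤ (2 : ℝ) ^ (l * n) * (1 / 2) ^ ((l + 1) * n) :=
          mul_le_mul_of_nonneg_right h2 (by positivity)
      _ = (1 / 2) ^ n := by
          rw [add_mul, one_mul, pow_add, ← mul_assoc, ← mul_pow]
          norm_num
  have hsub : ((colorable l n).filter fun S => S ∉ genericSets l R n) ⊆
      Finset.univ.biUnion bad := by
    intro S hS
    obtain ⟨hS1, hS2⟩ := Finset.mem_filter.1 hS
    obtain ⟨h, hc⟩ := mem_colorable.1 hS1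
    refine Finset.mem_biUnion.2 ⟨h, Finset.mem_univ _, Finset.mem_filter.2
      ⟨Finset.mem_powerset.2 (isColoring_relOf_iff.1 hc), fun hg => hS2 ?_⟩⟩
    exact mem_genericSets.2 ⟨h, hg⟩
  calc _ ≤ ((Finset.univ.biUnion bad).card : ℝ) := Nat.cast_le.2 (Finset.card_le_card hsub)
    _ ≤ ∑ h, ((bad h).card : ℝ) := by exact_mod_cast Finset.card_biUnion_le
    _ = ∑ h ∈ bal, ((bad h).card : ℝ) +
        ∑ h ∈ Finset.univ.filter (fun h => h ∉ bal), ((bad h).card : ℝ) := by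
        rw [← Finset.sum_filter_add_sum_filter_not Finset.univ (fun h => h ∈ bal)]
        congr 2
        ext h
        simp
    _ ≤ _ := by linarith

/-- The bound of `card_filter_not_generic` for balanced colourings tends to zero. -/
theorem tendsto_bound {l R : ℕ} (hl : 1 ≤ l) (hR : 1 ≤ R) :
    Tendsto (fun n : ℕ => ((R : ℝ) + 1) * ((n : ℝ) + 1) ^ R * 2 ^ R * l *
      (1 - (1 / 2) ^ R) ^ (n / (2 * l) - R)) atTop (𝓝 0) := by
  set c : ℝ := 1 - (1 / 2) ^ R with hc
  have hhalf : (1 / 2 : ℝ) ^ R ≤ 1 / 2 := by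
    simpa using pow_le_pow_of_le_one (a := (1 / 2 : ℝ)) (by norm_num) (by norm_num) hR
  have hc0 : 0 < c := by linarith
  have hc1 : c < 1 := sub_lt_self _ (by positivity)
  -- The subtraction in `t` truncates; in any case `n / (2 l) < t n`.
  let t : ℕ → ℕ := fun n => n / (2 * l) - R + (R + 1)
  have ht : Tendsto t atTop atTop := by
    exact (tendsto_add_atTop_nat (R + 1)).comp ((tendsto_sub_atTop_nat R).comp
      (Nat.tendsto_div_const_atTop (by omega)))
  have hlim := (tendsto_pow_const_mul_const_pow_of_abs_lt_one R
    (abs_lt.2 ⟨by linarith, hc1⟩ : |c| < 1)).comp ht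
  have hlim' := hlim.const_mul (((R : ℝ) + 1) * (2 * l) ^ R * 2 ^ R * l / c ^ (R + 1))
  rw [mul_zero] at hlim'
  refine squeeze_zero (fun n => by positivity) (fun n => ?_) hlim'
  have h1 : ((n : ℝ) + 1) ≤ 2 * l * t n := by
    have h2 : n + 1 ≤ 2 * l * t n := by
      have h3 : n < 2 * l * (n / (2 * l) + 1) := Nat.lt_mul_div_succ n (by omega)
      have h4 : n / (2 * l) + 1 ≤ t n := by
        simp only [t]
        omega
      exact h3.trans_le (Nat.mul_le_mul_left _ h4)
    exact_mod_cast h2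
  have h2 : c ^ (n / (2 * l) - R) = c ^ t n / c ^ (R + 1) := by
    rw [eq_div_iff (by positivity), ← pow_add]
  calc _ ≤ ((R : ℝ) + 1) * (2 * l * t n) ^ R * 2 ^ R * l * c ^ (n / (2 * l) - R) := by gcongr
    _ = _ := by
      rw [h2, mul_pow]
      simp only [Function.comp_apply]
      ring

theorem genericSets_subset_colorable (l R n : ℕ) : genericSets l R n ⊆ colorable l n := by
  intro S hS
  obtain ⟨h, hg⟩ := mem_genericSets.1 hS
  exact mem_colorable.2 ⟨h, hg.isColoring⟩

theorem card_colorable_pos {l : ℕ} (hl : 1 ≤ l) (n : ℕ) : 0 < (colorable l n).card :=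
  Finset.card_pos.2 ⟨∅, mem_colorable.2 ⟨residueColoring n hl,
    isColoring_relOf_iff.2 (Finset.empty_subset _)⟩⟩

/-- Almost all digraphs with a homomorphism to `T_l` are generic over sets of at most `R`
vertices. -/
theorem tendsto_card_genericSets {l R : ℕ} (hl : 1 ≤ l) (hR : 1 ≤ R) :
    Tendsto (fun n => ((genericSets l R n).card : ℝ) / (colorable l n).card) atTop (𝓝 1) := by
  classical
  have h0 := tendsto_bound hl hR
  set ε : ℕ → ℝ := fun n => ((R : ℝ) + 1) * ((n : ℝ) + 1) ^ R * 2 ^ R * l *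
      (1 - (1 / 2) ^ R) ^ (n / (2 * l) - R) with hε
  have hlow : Tendsto (fun n => 1 - (2 * ε n + (1 / 2) ^ n)) atTop (𝓝 1) := by
    have h1 := tendsto_pow_atTop_nhds_zero_of_lt_one (r := (1 / 2 : ℝ)) (by norm_num)
      (by norm_num)
    simpa using tendsto_const_nhds.sub ((h0.const_mul 2).add h1)
  have hc0 : (0 : ℝ) ≤ 1 - (1 / 2) ^ R :=
    sub_nonneg.2 (pow_le_one₀ (by norm_num) (by norm_num))
  refine tendsto_of_tendsto_of_tendsto_of_le_of_le' hlow tendsto_const_nhds ?_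
    (Eventually.of_forall fun n => div_le_one_of_le₀
      (Nat.cast_le.2 (Finset.card_le_card (genericSets_subset_colorable l R n)))
      (Nat.cast_nonneg _))
  filter_upwards [h0.eventually_le_const (show (0 : ℝ) < 1 / 2 by norm_num),
    eventually_ge_atTop (4 * l ^ 2 * (2 * l + 3))] with n hn1 hn2
  have hpos : (0 : ℝ) < (colorable l n).card := Nat.cast_pos.2 (card_colorable_pos hl n)
  have key := card_colorable_not_generic hl hR hn2 (ε := ε n) (by positivity) hn1 fun h hh => by
    have := card_filter_not_generic h R (n / (2 * l)) fun k => Nat.div_le_of_le_mul (hh k)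
    rwa [Fintype.card_fin] at this
  have hsplit := Finset.card_filter_add_card_filter_not (s := colorable l n)
    (fun S => S ∈ genericSets l R n)
  rw [Finset.filter_mem_eq_inter,
    Finset.inter_eq_right.2 (genericSets_subset_colorable l R n)] at hsplit
  have hsplit' : ((genericSets l R n).card : ℝ) +
      ((colorable l n).filter fun S => S ∉ genericSets l R n).card = (colorable l n).card := by
    exact_mod_cast hsplit
  rw [le_div_iff₀ hpos]
  linarith

/-- The digraph with a given set of edges. -/
def digraphOf {V : Type} (S : Finset (V × V)) : Digraph V :=
  ⟨relOf S⟩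

open Classical in
theorem ncard_digraph {n : ℕ} (p : Digraph (Fin n) → Prop) :
    {G | p G}.ncard =
      (Finset.univ.filter fun S : Finset (Fin n × Fin n) => p (digraphOf S)).card := by
  have hinj : Function.Injective (digraphOf : Finset (Fin n × Fin n) → Digraph (Fin n)) := by
    intro S S' h
    ext ⟨u, v⟩
    exact iff_of_eq (congrFun (congrFun (congrArg Digraph.Adj h) u) v)
  have himg : {G | p G} = digraphOf ''
      ((Finset.univ.filter fun S : Finset (Fin n × Fin n) => p (digraphOf S)) :
        Set (Finset (Fin n × Fin n))) := by
    ext G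
    constructor
    · intro hG
      have hGS : digraphOf (Finset.univ.filter fun q : Fin n × Fin n => G.Adj q.1 q.2) = G := by
        ext u v
        simp [digraphOf, relOf]
      refine ⟨_, ?_, hGS⟩
      simpa [hGS] using hG
    · rintro ⟨S, hS, rfl⟩
      simpa using hS
  rw [himg, Set.ncard_image_of_injective _ hinj, Set.ncard_coe_finset]

theorem mapsTo_transitiveTournament_iff {V : Type} {l : ℕ} (G : Digraph V) :
    MapsTo G (transitiveTournament l) ↔ ∃ h : V → Fin l, IsColoring G.Adj h :=
  ⟨fun ⟨f⟩ => ⟨f, fun _ _ huv => f.map_rel huv⟩, fun ⟨h, hc⟩ => ⟨⟨h, fun {u v} huv => hc u v huv⟩⟩⟩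

open Classical in
theorem fraction_csp_eq (l n : ℕ) (φ : Language.graph.Sentence) :
    fraction (Csp (transitiveTournament l)) φ n =
      (((colorable l n).filter fun S => Satisfies (digraphOf S) φ).card : ℝ) /
        (colorable l n).card := by
  have hmem : ∀ S : Finset (Fin n × Fin n),
      digraphOf S ∈ Csp (transitiveTournament l) (Fin n) ↔ S ∈ colorable l n := by
    intro S
    have : digraphOf S ∈ Csp (transitiveTournament l) (Fin n) ↔
        Finite (Fin n) ∧ MapsTo (digraphOf S) (transitiveTournament l) := Iff.rfl
    rw [this, mapsTo_transitiveTournament_iff, mem_colorable]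
    exact and_iff_right inferInstance
  have h1 := ncard_digraph (n := n)
    (fun G => G ∈ Csp (transitiveTournament l) (Fin n) ∧ Satisfies G φ)
  have h2 := ncard_digraph (n := n) (fun G => G ∈ Csp (transitiveTournament l) (Fin n))
  simp only [hmem] at h1 h2
  have h3 : (Csp (transitiveTournament l) (Fin n)).ncard = (colorable l n).card :=
    h2.trans (congrArg Finset.card (Finset.filter_univ_mem _))
  rw [fraction, h3, h1]
  congr 3
  ext S
  simp

/-- The sentences that hold in a generic digraph hold in almost all digraphs with a homomorphism to
`T_l`. -/
theorem tendsto_fraction_of_satisfies {l : ℕ} (hl : 1 ≤ l) {V : Type} (U : Digraph V)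
    {h : V → Fin l} (hg : IsGeneric U.Adj h) {φ : Language.graph.Sentence} (hφ : Satisfies U φ) :
    Tendsto (fraction (Csp (transitiveTournament l)) φ) atTop (𝓝 1) := by
  classical
  obtain ⟨R, hR⟩ := exists_genericity_bound_sentence l φ
  refine tendsto_of_tendsto_of_tendsto_of_le_of_le
    (tendsto_card_genericSets hl (le_max_right R 1)) tendsto_const_nhds (fun n => ?_)
    (fun n => ?_)
  · rw [fraction_csp_eq]
    refine div_le_div_of_nonneg_right (Nat.cast_le.2 (Finset.card_le_card fun S hS => ?_))
      (Nat.cast_nonneg _)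
    obtain ⟨h', hg'⟩ := mem_genericSets.1 hS
    refine Finset.mem_filter.2 ⟨genericSets_subset_colorable _ _ _ hS, ?_⟩
    exact (@hR (Fin n) V (toStructure (digraphOf S)) (toStructure U) h' h
      (hg'.mono (le_max_left _ _)) (hg R)).2 hφ
  · rw [fraction_csp_eq]
    exact div_le_one_of_le₀ (Nat.cast_le.2 (Finset.card_filter_le _ _)) (Nat.cast_nonneg _)

theorem satisfies_not_iff {V : Type} (G : Digraph V) (φ : Language.graph.Sentence) :
    Satisfies G (∼φ) ↔ ¬ Satisfies G φ :=
  Iff.rfl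

theorem fraction_not {l : ℕ} (hl : 1 ≤ l) (φ : Language.graph.Sentence) (n : ℕ) :
    fraction (Csp (transitiveTournament l)) (∼φ) n =
      1 - fraction (Csp (transitiveTournament l)) φ n := by
  classical
  have hpos : (0 : ℝ) < (colorable l n).card := Nat.cast_pos.2 (card_colorable_pos hl n)
  have hsplit : (((colorable l n).filter fun S => Satisfies (digraphOf S) φ).card : ℝ) +
      ((colorable l n).filter fun S => ¬ Satisfies (digraphOf S) φ).card =
        (colorable l n).card := by
    exact_mod_cast Finset.card_filter_add_card_filter_not _
  rw [fraction_csp_eq, fraction_csp_eq, eq_sub_iff_add_eq, ← add_div,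
    div_eq_one_iff_eq hpos.ne', ← hsplit, add_comm]
  simp only [satisfies_not_iff]

/-- The almost-sure theory of `Csp T_l` is the theory of a generic digraph. -/
theorem almostSureTheory_csp {l : ℕ} (hl : 1 ≤ l) {V : Type} (U : Digraph V)
    {h : V → Fin l} (hg : IsGeneric U.Adj h) :
    almostSureTheory (Csp (transitiveTournament l)) = theoryOf U := by
  ext φ
  refine ⟨fun hφ => ?_, fun hφ => tendsto_fraction_of_satisfies hl U hg hφ⟩
  by_contra hU
  have h1 := tendsto_fraction_of_satisfies hl U hg ((satisfies_not_iff U φ).2 hU)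
  have h2 : Tendsto (fraction (Csp (transitiveTournament l)) φ) atTop (𝓝 1) := hφ
  have h3 : Tendsto (fraction (Csp (transitiveTournament l)) (∼φ)) atTop (𝓝 (1 - 1)) := by
    simpa only [funext (fraction_not hl φ)] using tendsto_const_nhds.sub h2
  exact absurd (tendsto_nhds_unique h1 h3) (by norm_num)

end Asymptotics

end AlmostSure

/-- For `ℓ ≥ 1`, the theory `ppTheory T_ℓ` has a model companion. Every model companion `T'` of it
is `ω`-categorical and has a countable model, and for its countable model `U` (unique up to
isomorphism): a countable digraph embeds into `U` iff it maps homomorphically to `T_ℓ`, and the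
almost-sure theory of `Csp T_ℓ` equals the first-order theory of `U`. -/
theorem proposition4p13 (l : ℕ) (hl : 1 ≤ l) :
    (∃ T' : Language.graph.Theory,
      AlmostSure.IsModelCompanion
        (AlmostSure.ppTheory (AlmostSure.transitiveTournament l)) T') ∧
    ∀ T' : Language.graph.Theory,
      AlmostSure.IsModelCompanion
        (AlmostSure.ppTheory (AlmostSure.transitiveTournament l)) T' →
      AlmostSure.IsOmegaCategorical T' ∧
      (∃ (V : Type) (U : Digraph V),
        Nonempty V ∧ Countable V ∧ T' ⊆ AlmostSure.theoryOf U) ∧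
      ∀ (V : Type) (U : Digraph V),
        Nonempty V → Countable V → T' ⊆ AlmostSure.theoryOf U →
        (∀ (W : Type) (G : Digraph W), Countable W →
          (AlmostSure.EmbedsIn G U ↔
            AlmostSure.MapsTo G (AlmostSure.transitiveTournament l))) ∧
        AlmostSure.almostSureTheory (AlmostSure.Csp (AlmostSure.transitiveTournament l)) =
          AlmostSure.theoryOf U := by
  refine ⟨?_, fun T' hT => ⟨hT.isOmegaCategorical hl, hT.exists_countable_model hl,
    fun V U _ _ hU => ?_⟩⟩
  · obtain ⟨E, h, hg⟩ := AlmostSure.exists_isGeneric_nat hl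
    let := AlmostSure.toStructure (⟨E⟩ : Digraph ℕ)
    exact ⟨_, AlmostSure.IsGeneric.isModelCompanion (U := ℕ) (h := h) hg⟩
  · let := AlmostSure.toStructure U
    have hmod : V ⊨ T' := ⟨fun φ hφ => hU hφ⟩
    obtain ⟨h, hg⟩ := hT.exists_isGeneric hl V
    have hgU : AlmostSure.IsGeneric U.Adj h := hg
    refine ⟨fun W G _ => ?_, AlmostSure.almostSureTheory_csp hl U hgU⟩
    rw [AlmostSure.mapsTo_transitiveTournament_iff]
    constructor
    · rintro ⟨f⟩
      exact ⟨fun w => h (f w), fun u v huv => (hgU 0).isColoring _ _ (f.map_rel_iff.2 huv)⟩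
    · rintro ⟨c, hc⟩
      exact AlmostSure.IsGeneric.nonempty_embedding hc hgU
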